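/- Let $\beta>0$, $r>0$, and let $\xi_N\in(0,1)$, $N=1,2,\dots$, satisfy $(1-\xi_N)N\to r$ as $N\to\infty$. Notation. A point configuration is an arbitrary subset $X\subset\mathbb Z_{\ge0}$; the space $\mathrm{Conf}=\{0,1\}^{\mathbb Z_{\ge0}}$ of configurations carries the product topology. A probability measure $P$ on $\mathrm{Conf}$ is determinantal with correlation kernel $K$ if $P(X\supset Y)=\det[K(x,y)]_{x,y\in Y}$ for every finite $Y\subset\mathbb Z_{\ge0}$. For $\xi\in(0,1)$ let $W(x)=\frac{\Gamma(\beta+x)}{\Gamma(\beta)\,x!}\xi^x$, $x\in\mathbb Z_{\ge0}$, let $P_0,P_1,\dots$ be the orthogonal polynomials (with $\deg P_n=n$) with weight $W$ on $\mathbb Z_{\ge0}$ (the Meixner polynomials), and let $\|P_n\|$ be their norms in $\ell^2(\mathbb Z_{\ge0},W)$. The $N$-particle Meixner ensemble $\mathrm{Meixner}(N,\beta,\xi)$ is the determinantal measure with kernel $$K_{N,\beta,\xi}(x,y)=\sqrt{W(x)W(y)}\,\sum_{n=0}^{N-1}\frac{P_n(x)P_n(y)}{\|P_n\|^2}.$$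 Let $\widetilde L_0,\widetilde L_1,\dots$ be the orthonormal polynomials with positive leading coefficients for the weight $t^{\beta-1}e^{-t}\,dt$ on $(0,\infty)$. The discrete Laguerre ensemble $\mathrm{DL}^-(r;\beta)$ is the determinantal measure with kernel $$K_{\mathrm{DL}^-(r;\beta)}(x,y)=\int_0^r\widetilde L_x(t)\widetilde L_y(t)\,t^{\beta-1}e^{-t}\,dt .$$ Theorem. For every $N\ge1$ the measure $\mathrm{Meixner}(N,\beta,\xi_N)$ exists and is unique, $\mathrm{DL}^-(r;\beta)$ exists and is unique, and, as $N\to\infty$, $$\mathrm{Meixner}(N,\beta,\xi_N)\to\mathrm{DL}^-(r;\beta)$$ weakly as probability measures on $\mathrm{Conf}$. Moreover, $K_{N,\beta,\xi_N}(x,y)$ and $(-1)^{x+y}K_{\mathrm{DL}^-(r;\beta)}(x,y)$ are the matrices of orthogonal projection operators on $\ell^2(\mathbb Z_{\ge0})$, and the former operators converge strongly to the latter one as $N\to\infty$. -/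

import Mathlib

open MeasureTheory Filter
open scoped Topology

noncomputable section

/-! ### Orthogonal polynomials of a measure on the real line -/

/-- The monic orthogonal polynomials of a measure `μ` on `ℝ` (with finite moments and
infinite support), obtained from `1, t, t ^ 2, …` by the Gram-Schmidt process in `L²(ℝ, μ)`. -/
def monicOrthoPoly (μ : Measure ℝ) (n : ℕ) : Polynomial ℝ :=
  Polynomial.X ^ n - ∑ k : Fin n,
    Polynomial.C ((∫ t, t ^ n * (monicOrthoPoly μ k.1).eval t ∂μ) /
      (∫ t, ((monicOrthoPoly μ k.1).eval t) ^ 2 ∂μ)) * monicOrthoPoly μ k.1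
termination_by n
decreasing_by all_goals exact k.2

/-- The squared norm in `L²(ℝ, μ)` of the `n`-th monic orthogonal polynomial. -/
def orthoPolyNormSq (μ : Measure ℝ) (n : ℕ) : ℝ :=
  ∫ t, ((monicOrthoPoly μ n).eval t) ^ 2 ∂μ

/-- The value at `t` of the `n`-th orthonormal polynomial (with positive leading coefficient). -/
def orthonormalPoly (μ : Measure ℝ) (n : ℕ) (t : ℝ) : ℝ :=
  (monicOrthoPoly μ n).eval t / Real.sqrt (orthoPolyNormSq μ n)

/-! ### Point configurations on `ℕ` and determinantal point processes -/

/-- The space of point configurations (arbitrary subsets) of `ℕ`: the subset `X` is encoded by its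
indicator, so that `x` belongs to `X` if and only if `X x = true`. It carries the product topology,
which makes it compact and totally disconnected, and the product (= Borel) σ-algebra. -/
abbrev Conf : Type := ℕ → Bool

/-- The event that the random configuration contains the finite set `Y`. -/
def cylinderSet (Y : Finset ℕ) : Set Conf := {X | ∀ x ∈ Y, X x = true}

/-- `P` is the determinantal measure on `Conf` with correlation kernel `K` (with respect to the
counting measure on `ℕ`): the correlation functions, that is, the probabilities that the random
configuration contains given distinct points, are the corresponding symmetric minors of `K`. -/
def IsDeterminantal (P : ProbabilityMeasure Conf) (K : ℕ → ℕ → ℝ) : Prop :=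
  ∀ Y : Finset ℕ,
    (P : Measure Conf).real (cylinderSet Y) = (Matrix.of fun i j : Y => K i.1 j.1).det

/-! ### The Meixner ensemble -/

/-- The Meixner weight function `(β)_x ξ ^ x / x!`. -/
def meixnerWeight (β ξ : ℝ) (x : ℕ) : ℝ :=
  Real.Gamma (β + x) / (Real.Gamma β * (x.factorial : ℝ)) * ξ ^ x

/-- The Meixner weight function as a measure on `ℝ` carried by `ℕ`. -/
def meixnerMeasure (β ξ : ℝ) : Measure ℝ :=
  Measure.sum fun x : ℕ => ENNReal.ofReal (meixnerWeight β ξ x) • Measure.dirac (x : ℝ)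

/-- The correlation kernel, with respect to the counting measure on `ℕ`, of the `N`-particle
Meixner orthogonal polynomial ensemble (the Christoffel-Darboux kernel times the square root of
the weights). -/
def meixnerKernel (N : ℕ) (β ξ : ℝ) (x y : ℕ) : ℝ :=
  Real.sqrt (meixnerWeight β ξ x * meixnerWeight β ξ y) *
    ∑ n ∈ Finset.range N,
      (monicOrthoPoly (meixnerMeasure β ξ) n).eval (x : ℝ) *
        (monicOrthoPoly (meixnerMeasure β ξ) n).eval (y : ℝ) /
          orthoPolyNormSq (meixnerMeasure β ξ) n

/-! ### The discrete Laguerre ensemble -/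

/-- The Laguerre weight measure `t ^ (β - 1) * exp (-t) dt` on `(0, ∞)`. -/
def laguerreMeasure (β : ℝ) : Measure ℝ :=
  (volume.restrict (Set.Ioi (0 : ℝ))).withDensity
    fun t => ENNReal.ofReal (t ^ (β - 1) * Real.exp (-t))

/-- The correlation kernel of the discrete Laguerre ensemble of type minus, with parameters
`r` and `β`. -/
def discreteLaguerreKernelMinus (r β : ℝ) (x y : ℕ) : ℝ :=
  ∫ t in Set.Iio r, orthonormalPoly (laguerreMeasure β) x t *
    orthonormalPoly (laguerreMeasure β) y t ∂(laguerreMeasure β)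

/-! ### Projections on `ℓ²(ℕ)` -/

/-- The real Hilbert space `ℓ²(ℕ)`. -/
abbrev EllTwo : Type := lp (fun _ : ℕ => ℝ) 2

/-- `T` is an orthogonal projection on `ℓ²(ℕ)` whose matrix in the standard basis is `K`. -/
def IsProjectionWithKernel (T : EllTwo →L[ℝ] EllTwo) (K : ℕ → ℕ → ℝ) : Prop :=
  IsStarProjection T ∧ ∀ x y : ℕ, (T (lp.single 2 y (1 : ℝ)) : ℕ → ℝ) x = K x y

end

noncomputable section

/-! ### Determinantal measures with a contraction kernel -/

/-! The engine is the self-duality of the Meixner polynomials. Normalised as `₂F₁(-n, -x; β; 1 - 1 /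
ξ)`, they are symmetric in degree and variable (`meixnerPoly_eval_comm`), and their squared norms
are the reciprocals of `(1 - ξ) ^ β` times the weight (`meixner_normSq`). The Christoffel-Darboux
sum over degrees `n < N` thus becomes a scalar product of the two Meixner polynomials of fixed
degrees `x` and `y`, truncated to the nodes `n < N` (`meixnerKernel_eq`). With `t = (1 - ξ) n` this
is a Riemann sum of mesh `1 - ξ`: the weight tends to the Gamma density, the polynomials tend to
Laguerre polynomials, and the cut-off `(1 - ξ) N` tends to `r` (`tendsto_sum_meixner`). Positive
leading coefficients in the Laguerre normalisation account for the sign `(-1) ^ (x + y)`.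

Entrywise convergence suffices for the rest. Both kernels satisfy `∑ z, K x z * K y z = K x y`,
hence are matrices of projections (`exists_isProjectionWithKernel`). For Meixner this is
orthonormality of finitely many functions; for Laguerre it is Parseval's identity, which needs
completeness of the Laguerre polynomials, obtained from exponential moments
(`ae_eq_zero_of_integral_pow_mul_eq_zero`). A projection kernel defines a unique determinantal
measure: inclusion-exclusion constructs it on finite windows, and compactness of `Conf` passes to
the limit. Convergence of minors gives weak convergence of measures, and for projections entrywise
convergence upgrades to strong convergence. -/

theorem Matrix.det_nonneg_of_quadratic_form_nonneg {ι : Type*} [Fintype ι] [DecidableEq ι]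
    (M : Matrix ι ι ℝ) (hM : ∀ v : ι → ℝ, 0 ≤ v ⬝ᵥ M.mulVec v) : 0 ≤ M.det := by
  by_contra! hneg
  -- On the segment from the identity to `M` the determinant would vanish at some `s < 1`, but there
  -- the quadratic form is at least `(1 - s) * (v ⬝ᵥ v)`. Symmetry of `M` is not needed, which
  -- matters for the row-mixed matrices below.
  have hcont : Continuous fun s : ℝ => ((1 - s) • (1 : Matrix ι ι ℝ) + s • M).det := by
    apply Continuous.matrix_det
    fun_prop
  have h01 : (0 : ℝ) ∈ Set.Icc (((1 - (1 : ℝ)) • (1 : Matrix ι ι ℝ) + (1 : ℝ) • M).det)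
      (((1 - (0 : ℝ)) • (1 : Matrix ι ι ℝ) + (0 : ℝ) • M).det) := by
    simp [hneg.le]
  obtain ⟨s, hs, hs0⟩ := intermediate_value_Icc' (zero_le_one' ℝ) hcont.continuousOn h01
  have hs1 : s < 1 := by
    refine lt_of_le_of_ne hs.2 ?_
    rintro rfl
    simp at hs0
    exact hneg.ne hs0
  obtain ⟨v, hv, hv0⟩ := Matrix.exists_mulVec_eq_zero_iff.mpr hs0
  have h1 : 0 < v ⬝ᵥ v := by
    refine lt_of_le_of_ne (Finset.sum_nonneg fun i _ => mul_self_nonneg _) ?_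
    intro h
    exact hv (dotProduct_self_eq_zero.mp h.symm)
  have h2 := congrArg (v ⬝ᵥ ·) hv0
  simp only [Matrix.add_mulVec, Matrix.smul_mulVec, Matrix.one_mulVec, dotProduct_add,
    dotProduct_smul, smul_eq_mul, dotProduct_zero] at h2
  have h3 := mul_pos (sub_pos.mpr hs1) h1
  have h4 := mul_nonneg hs.1 (hM v)
  linarith

/-- This determinant will be the probability that, within a finite window, `s` is exactly the set of
empty sites. Splitting `v = u + w` along `s`, the cross terms `u ⬝ᵥ K w` and `w ⬝ᵥ K u` cancel by
symmetry, leaving the forms of `1 - K` at `u` and of `K` at `w`. -/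
theorem Matrix.det_piecewise_one_sub_nonneg {ι : Type*} [Fintype ι] [DecidableEq ι]
    (K : Matrix ι ι ℝ) (hsymm : K.IsSymm) (h0 : ∀ v : ι → ℝ, 0 ≤ v ⬝ᵥ K.mulVec v)
    (h1 : ∀ v : ι → ℝ, v ⬝ᵥ K.mulVec v ≤ v ⬝ᵥ v) (s : Finset ι) :
    0 ≤ (Matrix.of (s.piecewise (1 - K) K)).det := by
  apply Matrix.det_nonneg_of_quadratic_form_nonneg
  intro v
  set u : ι → ℝ := s.piecewise v 0 with hu
  set w : ι → ℝ := s.piecewise 0 v with hw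
  have hv : v = u + w := by
    ext i
    by_cases hi : i ∈ s <;> simp [hu, hw, hi]
  have hMv : v ⬝ᵥ (Matrix.of (s.piecewise (1 - K) K)).mulVec v =
      u ⬝ᵥ (1 - K).mulVec v + w ⬝ᵥ K.mulVec v := by
    simp only [dotProduct, ← Finset.sum_add_distrib]
    refine Finset.sum_congr rfl fun i _ => ?_
    by_cases hi : i ∈ s
    · have h : (Matrix.of (s.piecewise (1 - K) K)).mulVec v i = (1 - K).mulVec v i :=
        congrArg (· ⬝ᵥ v) (Finset.piecewise_eq_of_mem s (1 - K) K hi)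
      rw [h]
      simp [hu, hw, hi]
    · have h : (Matrix.of (s.piecewise (1 - K) K)).mulVec v i = K.mulVec v i :=
        congrArg (· ⬝ᵥ v) (Finset.piecewise_eq_of_notMem s (1 - K) K hi)
      rw [h]
      simp [hu, hw, hi]
  have hsw : u ⬝ᵥ K.mulVec w = w ⬝ᵥ K.mulVec u := by
    rw [Matrix.dotProduct_mulVec, ← Matrix.mulVec_transpose, hsymm.eq, dotProduct_comm]
  have huw : u ⬝ᵥ w = 0 := by
    refine Finset.sum_eq_zero fun i _ => ?_
    by_cases hi : i ∈ s <;> simp [hu, hw, hi]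
  rw [hMv, hv]
  simp only [Matrix.sub_mulVec, Matrix.one_mulVec, Matrix.mulVec_add, dotProduct_add,
    dotProduct_sub]
  have := h1 u
  have := h0 w
  linarith

theorem Matrix.det_piecewise_one {ι : Type*} [Fintype ι] [DecidableEq ι]
    (K : Matrix ι ι ℝ) (Y : Finset ι) :
    (Matrix.of (Yᶜ.piecewise (1 : Matrix ι ι ℝ) K)).det =
      (Matrix.of fun i j : Y => K i.1 j.1).det := by
  have hM : ∀ i j, Matrix.of (Yᶜ.piecewise (1 : Matrix ι ι ℝ) K) i j =
      if i ∈ Y then K i j else (1 : Matrix ι ι ℝ) i j := by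
    intro i j
    by_cases hi : i ∈ Y <;> simp [Finset.piecewise, hi]
  generalize Matrix.of (Yᶜ.piecewise (1 : Matrix ι ι ℝ) K) = M at hM
  rw [Matrix.twoBlockTriangular_det M (fun i => i ∈ Y)]
  · have h1 : M.toSquareBlockProp (fun i => ¬ i ∈ Y) = 1 := by
      ext i j
      rw [Matrix.toSquareBlockProp_def, Matrix.of_apply, hM, if_neg i.2]
      simp [Matrix.one_apply, Subtype.ext_iff]
    have h2 : M.toSquareBlockProp (fun i => i ∈ Y) = Matrix.of fun i j : Y => K i.1 j.1 := by
      ext i j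
      rw [Matrix.toSquareBlockProp_def, Matrix.of_apply, hM, if_pos i.2, Matrix.of_apply]
    rw [h1, h2, Matrix.det_one, mul_one]
    congr!
  · intro i hi j hj
    have hij : i ≠ j := by rintro rfl; exact hi hj
    rw [hM, if_neg hi, Matrix.one_apply_ne hij]

/-- Inclusion-exclusion as multilinearity in the rows: summing the choices `1 - K` or `K` in each
row outside `Y` puts the identity row there. -/
theorem Matrix.sum_det_piecewise_one_sub {ι : Type*} [Fintype ι] [DecidableEq ι]
    (K : Matrix ι ι ℝ) (Y : Finset ι) :
    ∑ s ∈ Yᶜ.powerset, (Matrix.of (s.piecewise (1 - K) K)).det =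
      (Matrix.of fun i j : Y => K i.1 j.1).det := by
  rw [← Matrix.det_piecewise_one]
  have := (Matrix.detRowAlternating (n := ι) (R := ℝ)).toMultilinearMap.map_piecewise_add
    (fun i => (1 - K) i) (fun i => K i) Yᶜ
  have h2 : (fun i => (1 - K) i) + (fun i => K i) = (1 : Matrix ι ι ℝ) := by
    ext i j; simp
  rw [h2] at this
  exact this.symm

/-! ### Cylinder events and weak convergence on `Conf`. -/

theorem measurableSet_cylinderSet (Y : Finset ℕ) : MeasurableSet (cylinderSet Y) := by
  have : cylinderSet Y = ⋂ x ∈ Y, (fun X : Conf => X x) ⁻¹' {true} := by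
    ext X; simp [cylinderSet]
  rw [this]
  exact Finset.measurableSet_biInter _ fun x _ =>
    (measurable_pi_apply x) (MeasurableSet.singleton true)

theorem isClopen_cylinderSet (Y : Finset ℕ) : IsClopen (cylinderSet Y) := by
  have : cylinderSet Y = ⋂ x ∈ Y, (fun X : Conf => X x) ⁻¹' {true} := by
    ext X; simp [cylinderSet]
  rw [this]
  exact isClopen_biInter_finset fun x _ => (isClopen_discrete _).preimage (continuous_apply x)

/-- The cylinder events form a π-system, since intersections correspond to unions of the finite
sets, and they generate the σ-algebra. -/
theorem ProbabilityMeasure.ext_of_cylinderSet {P Q : ProbabilityMeasure Conf}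
    (h : ∀ Y : Finset ℕ, (P : Measure Conf).real (cylinderSet Y) =
      (Q : Measure Conf).real (cylinderSet Y)) : P = Q := by
  apply Subtype.ext
  have : IsProbabilityMeasure P.1 := P.2
  have : IsProbabilityMeasure Q.1 := Q.2
  refine ext_of_generate_finite (Set.range cylinderSet) ?_ ?_ ?_ (by simp)
  · apply le_antisymm
    · refine iSup_le fun n => ?_
      rw [← measurable_iff_comap_le]
      apply measurable_to_bool
      apply MeasurableSpace.measurableSet_generateFrom
      exact ⟨{n}, by ext X; simp [cylinderSet]⟩
    · apply MeasurableSpace.generateFrom_le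
      rintro _ ⟨Y, rfl⟩
      exact measurableSet_cylinderSet Y
  · rintro _ ⟨Y, rfl⟩ _ ⟨Z, rfl⟩ _
    refine ⟨Y ∪ Z, ?_⟩
    ext X
    simp only [cylinderSet, Finset.mem_union, Set.mem_ofPred_eq, Set.mem_inter_iff]
    grind
  · rintro _ ⟨Y, rfl⟩
    exact (measureReal_eq_measureReal_iff).mp (h Y)

theorem tendsto_cylinderSet_of_tendsto {ι : Type*} {l : Filter ι}
    {M : ι → ProbabilityMeasure Conf} {D : ProbabilityMeasure Conf} (h : Tendsto M l (𝓝 D))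
    (Y : Finset ℕ) :
    Tendsto (fun i => (M i : Measure Conf).real (cylinderSet Y)) l
      (𝓝 ((D : Measure Conf).real (cylinderSet Y))) := by
  have := ProbabilityMeasure.tendsto_measure_of_null_frontier_of_tendsto' h
    (E := cylinderSet Y) (by simp [(isClopen_cylinderSet Y).frontier_eq])
  exact (ENNReal.tendsto_toReal (measure_ne_top _ _)).comp this

/-- Convergence of the correlation functions implies weak convergence, the limit included. -/
theorem exists_tendsto_of_tendsto_cylinderSet {M : ℕ → ProbabilityMeasure Conf}
    {c : Finset ℕ → ℝ}
    (h : ∀ Y, Tendsto (fun N => (M N : Measure Conf).real (cylinderSet Y)) atTop (𝓝 (c Y))) :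
    ∃ D : ProbabilityMeasure Conf, Tendsto M atTop (𝓝 D) ∧
      ∀ Y, (D : Measure Conf).real (cylinderSet Y) = c Y := by
  have key : ∀ (D : ProbabilityMeasure Conf), MapClusterPt D atTop M →
      ∀ Y, (D : Measure Conf).real (cylinderSet Y) = c Y := by
    intro D hD Y
    obtain ⟨U, hU, hUD⟩ := mapClusterPt_iff_ultrafilter.mp hD
    exact tendsto_nhds_unique (tendsto_cylinderSet_of_tendsto hUD Y) ((h Y).mono_left hU)
  -- Probability measures on the compact space `Conf` form a compact space, so a cluster point
  -- exists; by `key` all cluster points share their correlation functions and hence coincide.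
  obtain ⟨D, hD⟩ := exists_clusterPt_of_compactSpace (map M atTop)
  refine ⟨D, ?_, key D hD⟩
  refine le_nhds_of_unique_clusterPt ?_
  intro D' hD'
  exact ProbabilityMeasure.ext_of_cylinderSet fun Y => by rw [key D hD, key D' hD']

/-- The law is a finite mixture of point masses: the configuration whose empty sites among the first
`n` are exactly `s` gets mass `q s`, and every site from `n` on is empty. -/
theorem exists_probabilityMeasure_cylinderSet_fin (K : ℕ → ℕ → ℝ) (n : ℕ)
    (hsymm : ∀ x y, K x y = K y x)
    (h0 : ∀ v : Fin n → ℝ, 0 ≤ v ⬝ᵥ (Matrix.of fun i j : Fin n => K i j).mulVec v)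
    (h1 : ∀ v : Fin n → ℝ, v ⬝ᵥ (Matrix.of fun i j : Fin n => K i j).mulVec v ≤ v ⬝ᵥ v) :
    ∃ P : ProbabilityMeasure Conf, ∀ Y : Finset ℕ, (∀ y ∈ Y, y < n) →
      (P : Measure Conf).real (cylinderSet Y) = (Matrix.of fun i j : Y => K i.1 j.1).det := by
  set A : Matrix (Fin n) (Fin n) ℝ := Matrix.of fun i j : Fin n => K i j with hA
  have hAs : A.IsSymm := by
    ext i j; exact hsymm _ _
  set q : Finset (Fin n) → ℝ := fun s => (Matrix.of (s.piecewise (1 - A) A)).det with hq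
  have hq0 : ∀ s, 0 ≤ q s := fun s => A.det_piecewise_one_sub_nonneg hAs h0 h1 s
  set X : Finset (Fin n) → Conf := fun s x => if hx : x < n then decide (⟨x, hx⟩ ∉ s) else false
  set μ : Measure Conf := ∑ s : Finset (Fin n), ENNReal.ofReal (q s) • Measure.dirac (X s) with hμ
  have hcyl : ∀ Y : Finset ℕ, (∀ y ∈ Y, y < n) →
      μ (cylinderSet Y) = ENNReal.ofReal (Matrix.of fun i j : Y => K i.1 j.1).det := by
    intro Y hY
    set Z : Finset (Fin n) := Finset.univ.filter fun i => (i : ℕ) ∈ Y with hZ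
    have hmem : ∀ s : Finset (Fin n), X s ∈ cylinderSet Y ↔ s ∈ Zᶜ.powerset := by
      intro s
      simp only [cylinderSet, Set.mem_ofPred_eq, Finset.mem_powerset, X]
      constructor
      · intro h i hi
        simp only [Finset.mem_compl, hZ, Finset.mem_filter, Finset.mem_univ, true_and]
        intro hiY
        have := h i hiY
        simp [hi] at this
      · intro h x hx
        have hxn := hY x hx
        simp only [hxn, dite_true, decide_eq_true_eq]
        intro hs
        have := h hs
        simp [hZ, hx] at this
    have hsum : (Matrix.of fun i j : Y => K i.1 j.1).det = ∑ s ∈ Zᶜ.powerset, q s := by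
      rw [hq, Matrix.sum_det_piecewise_one_sub A Z]
      let e : Z ≃ Y :=
        { toFun := fun i => ⟨i.1, (Finset.mem_filter.mp i.2).2⟩
          invFun := fun y => ⟨⟨y.1, hY y.1 y.2⟩, by simp [hZ]⟩
          left_inv := fun i => rfl
          right_inv := fun y => rfl }
      rw [← Matrix.det_submatrix_equiv_self e]
      rfl
    rw [hsum, ENNReal.ofReal_sum_of_nonneg (fun s _ => hq0 s), hμ, Measure.finsetSum_apply,
      ← Finset.sum_filter_add_sum_filter_not Finset.univ (fun s => s ∈ Zᶜ.powerset)]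
    rw [Finset.sum_eq_zero (s := Finset.univ.filter fun s => ¬ s ∈ Zᶜ.powerset), add_zero]
    · rw [Finset.filter_mem_eq_inter, Finset.univ_inter]
      refine Finset.sum_congr rfl fun s hs => ?_
      rw [Measure.smul_apply, Measure.dirac_apply' _ (measurableSet_cylinderSet Y),
        Set.indicator_of_mem ((hmem s).mpr hs)]
      simp
    · intro s hs
      rw [Measure.smul_apply, Measure.dirac_apply' _ (measurableSet_cylinderSet Y),
        Set.indicator_of_notMem (fun h => (Finset.mem_filter.mp hs).2 ((hmem s).mp h))]
      simp
  -- Total mass is the case `Y = ∅`, where the minor is an empty determinant, equal to `1`.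
  have hprob : IsProbabilityMeasure μ := by
    constructor
    have := hcyl ∅ (by simp)
    simpa [cylinderSet] using this
  refine ⟨⟨μ, hprob⟩, fun Y hY => ?_⟩
  -- Nonnegativity removes the truncation in `ENNReal.ofReal`; vectors on `Y` are extended by zero
  -- to the window.
  have hdet : 0 ≤ (Matrix.of fun i j : Y => K i.1 j.1).det := by
    apply Matrix.det_nonneg_of_quadratic_form_nonneg
    intro v
    set w : Fin n → ℝ := fun i => if h : (i : ℕ) ∈ Y then v ⟨i, h⟩ else 0 with hw
    have hsumY : ∀ g : Fin n → ℝ, (∑ i, w i * g i) = ∑ y : Y, v y * g ⟨y.1, hY y.1 y.2⟩ := by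
      intro g
      symm
      refine Finset.sum_of_injOn (fun y : Y => (⟨y.1, hY y.1 y.2⟩ : Fin n)) ?_ (by simp) ?_ ?_
      · intro a _ b _ hab
        exact Subtype.ext (Fin.mk.inj_iff.mp hab)
      · intro i _ hi
        have : (i : ℕ) ∉ Y := by
          intro h
          exact hi ⟨⟨i, h⟩, by simp, by simp⟩
        simp [hw, this]
      · intro y _
        simp [hw]
    have key : w ⬝ᵥ A.mulVec w = v ⬝ᵥ (Matrix.of fun i j : Y => K i.1 j.1).mulVec v := by
      rw [dotProduct, hsumY, dotProduct]
      refine Finset.sum_congr rfl fun y _ => ?_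
      congr 1
      rw [Matrix.mulVec, dotProduct_comm, dotProduct, hsumY, Matrix.mulVec, dotProduct_comm]
      rfl
    rw [← key]
    exact h0 w
  change (μ (cylinderSet Y)).toReal = _
  rw [hcyl Y hY, ENNReal.toReal_ofReal hdet]

/-! ### Determinantal measures of projection kernels. -/

theorem IsProjectionWithKernel.symm {T : EllTwo →L[ℝ] EllTwo} {K : ℕ → ℕ → ℝ}
    (h : IsProjectionWithKernel T K) (x y : ℕ) : K x y = K y x := by
  rw [← h.2, ← h.2]
  have h1 := h.1.isSelfAdjoint.isSymmetric (lp.single 2 x (1 : ℝ)) (lp.single 2 y (1 : ℝ))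
  simp only [ContinuousLinearMap.coe_coe] at h1
  rw [lp.inner_single_left, lp.inner_single_right] at h1
  simpa [eq_comm] using h1

/-- Holds because a self-adjoint idempotent satisfies `⟪w, T w⟫ = ‖T w‖ ^ 2`. It gives the bounds `0
≤ K ≤ 1` on every window. -/
theorem IsProjectionWithKernel.dotProduct_mulVec {T : EllTwo →L[ℝ] EllTwo} {K : ℕ → ℕ → ℝ}
    (h : IsProjectionWithKernel T K) (n : ℕ) (v : Fin n → ℝ) :
    v ⬝ᵥ (Matrix.of fun i j : Fin n => K i j).mulVec v =
      ‖T (∑ i, v i • (lp.single 2 (i : ℕ) (1 : ℝ) : EllTwo))‖ ^ 2 := by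
  set w : EllTwo := ∑ i, v i • (lp.single 2 (i : ℕ) (1 : ℝ) : EllTwo) with hw
  have h1 : inner ℝ (T w) (T w) = inner ℝ w (T w) := by
    have := h.1.isSelfAdjoint.isSymmetric w (T w)
    simp only [ContinuousLinearMap.coe_coe] at this
    rw [this]
    exact congrArg (fun S : EllTwo →L[ℝ] EllTwo => inner ℝ w (S w)) h.1.isIdempotentElem.eq
  rw [← real_inner_self_eq_norm_sq, h1]
  conv_rhs => rw [hw]
  simp only [sum_inner, map_sum, inner_sum, inner_smul_left, inner_smul_right, map_smul,
    lp.inner_single_left, h.2, dotProduct, Matrix.mulVec, Matrix.of_apply]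
  refine Finset.sum_congr rfl fun i _ => congrArg (v i * ·) (Finset.sum_congr rfl fun j _ => ?_)
  rw [h.symm i j]
  simp [mul_comm]

theorem norm_sq_sum_smul_single (n : ℕ) (v : Fin n → ℝ) :
    ‖∑ i, v i • (lp.single 2 (i : ℕ) (1 : ℝ) : EllTwo)‖ ^ 2 = v ⬝ᵥ v := by
  rw [← real_inner_self_eq_norm_sq]
  simp only [sum_inner, inner_sum, inner_smul_left, inner_smul_right, lp.inner_single_left,
    dotProduct]
  refine Finset.sum_congr rfl fun i _ => ?_
  rw [Finset.sum_eq_single i]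
  · simp
  · intro j _ hij
    have : (i : ℕ) ≠ (j : ℕ) := fun h => hij (Fin.ext h.symm)
    simp [lp.single_apply, this]
  · simp

theorem IsProjectionWithKernel.norm_apply_le {T : EllTwo →L[ℝ] EllTwo} {K : ℕ → ℕ → ℝ}
    (h : IsProjectionWithKernel T K) (w : EllTwo) : ‖T w‖ ≤ ‖w‖ := by
  have := T.le_opNorm w
  have h2 := h.1.norm_le
  nlinarith [norm_nonneg w]

theorem IsProjectionWithKernel.existsUnique_isDeterminantal {T : EllTwo →L[ℝ] EllTwo}
    {K : ℕ → ℕ → ℝ} (h : IsProjectionWithKernel T K) :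
    ∃! P : ProbabilityMeasure Conf, IsDeterminantal P K := by
  choose M hM using fun n => exists_probabilityMeasure_cylinderSet_fin K n h.symm
    (fun v => by rw [h.dotProduct_mulVec]; positivity)
    (fun v => by
      rw [h.dotProduct_mulVec, ← norm_sq_sum_smul_single]
      exact pow_le_pow_left₀ (norm_nonneg _) (h.norm_apply_le _) 2)
  obtain ⟨D, -, hD⟩ := exists_tendsto_of_tendsto_cylinderSet (M := M)
    (c := fun Y => (Matrix.of fun i j : Y => K i.1 j.1).det) (fun Y => by
      refine tendsto_const_nhds.congr' ?_
      -- The correlation at `Y` is constant as soon as the window contains `Y`.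
      filter_upwards [eventually_gt_atTop (Y.sup id)] with n hn
      exact (hM n Y fun y hy => lt_of_le_of_lt (Finset.le_sup (f := id) hy) hn).symm)
  exact ⟨D, hD, fun Q hQ => ProbabilityMeasure.ext_of_cylinderSet fun Y => by rw [hQ Y, hD Y]⟩

/-- Conjugating by a diagonal matrix of signs preserves all principal minors. The measure therefore
does not see the factor `(-1) ^ (x + y)`, which the operator statement requires. -/
theorem isDeterminantal_conj_sign (P : ProbabilityMeasure Conf) (K : ℕ → ℕ → ℝ) :
    IsDeterminantal P (fun x y => (-1 : ℝ) ^ (x + y) * K x y) ↔ IsDeterminantal P K := by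
  have hdet : ∀ Y : Finset ℕ, (Matrix.of fun i j : Y => (-1 : ℝ) ^ (i.1 + j.1) * K i.1 j.1).det =
      (Matrix.of fun i j : Y => K i.1 j.1).det := by
    intro Y
    have h1 := Matrix.det_mul_row (fun j : Y => (-1 : ℝ) ^ j.1)
      (Matrix.of fun i j : Y => (-1 : ℝ) ^ i.1 * K i.1 j.1)
    have h2 := Matrix.det_mul_column (fun j : Y => (-1 : ℝ) ^ j.1)
      (Matrix.of fun i j : Y => K i.1 j.1)
    simp only [Matrix.of_apply] at h1 h2
    rw [h2, ← mul_assoc, ← Finset.prod_mul_distrib] at h1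
    rw [Finset.prod_eq_one, one_mul] at h1
    · rw [← h1]
      congr 1
      ext i j
      simp only [Matrix.of_apply]
      ring
    · intro i _
      rw [← mul_pow]; simp
  simp only [IsDeterminantal, hdet]

theorem IsDeterminantal.tendsto {M : ℕ → ProbabilityMeasure Conf} {D : ProbabilityMeasure Conf}
    {K : ℕ → ℕ → ℕ → ℝ} {L : ℕ → ℕ → ℝ} (hM : ∀ N, 1 ≤ N → IsDeterminantal (M N) (K N))
    (hD : IsDeterminantal D L)
    (hK : ∀ x y, Tendsto (fun N => K N x y) atTop (𝓝 (L x y))) :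
    Tendsto M atTop (𝓝 D) := by
  obtain ⟨D', hD', hc⟩ := exists_tendsto_of_tendsto_cylinderSet (M := M)
    (c := fun Y => (Matrix.of fun i j : Y => L i.1 j.1).det) (fun Y => by
      have h1 : Tendsto (fun N => (Matrix.of fun i j : Y => K N i.1 j.1).det) atTop
          (𝓝 (Matrix.of fun i j : Y => L i.1 j.1).det) := by
        refine ((continuous_id.matrix_det).tendsto
          (Matrix.of fun i j : Y => L i.1 j.1)).comp ?_
        exact tendsto_pi_nhds.mpr fun i => tendsto_pi_nhds.mpr fun j => hK i.1 j.1
      refine h1.congr' ?_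
      filter_upwards [eventually_ge_atTop 1] with N hN
      exact (hM N hN Y).symm)
  rwa [ProbabilityMeasure.ext_of_cylinderSet (P := D) (Q := D')
    fun Y => by rw [hD Y, hc Y]]

/-! ### Projections on `ℓ²(ℕ)` given by reproducing kernels -/

/-- The identity says that the columns `k y` have Gram matrix `K`. Then `lp.single 2 y 1 - k y` is
orthogonal to every `k z`, so the projection onto the closed span of the columns sends the `y`-th
basis vector to `k y`. -/
theorem exists_isProjectionWithKernel (K : ℕ → ℕ → ℝ) (hsymm : ∀ x y, K x y = K y x)
    (hK : ∀ x y, HasSum (fun z => K x z * K y z) (K x y)) :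
    ∃ T : EllTwo →L[ℝ] EllTwo, IsProjectionWithKernel T K := by
  have hmem : ∀ y, Memℓp (fun x => K x y) 2 := by
    intro y
    refine memℓp_gen ?_
    refine (hK y y).summable.congr fun x => ?_
    rw [hsymm y x]
    simp [← pow_two]
  set k : ℕ → EllTwo := fun y => ⟨fun x => K x y, hmem y⟩ with hk
  have hkk : ∀ x y, inner ℝ (k x) (k y) = K x y := by
    intro x y
    refine (lp.hasSum_inner (k x) (k y)).unique ?_
    have : (fun z => inner ℝ (k x z) (k y z)) = fun z => K x z * K y z := by
      funext z
      change inner ℝ (K z x) (K z y) = _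
      rw [hsymm x z, hsymm y z]
      simp [mul_comm]
    rw [this]
    exact hK x y
  set V : Submodule ℝ EllTwo := (Submodule.span ℝ (Set.range k)).topologicalClosure with hV
  have hVc : CompleteSpace V := (Submodule.isClosed_topologicalClosure _).completeSpace_coe
  refine ⟨V.starProjection, isStarProjection_starProjection, fun x y => ?_⟩
  have hproj : V.starProjection (lp.single 2 y (1 : ℝ)) = k y := by
    refine Submodule.eq_starProjection_of_mem_orthogonal ?_ ?_
    · exact Submodule.le_topologicalClosure _ (Submodule.subset_span ⟨y, rfl⟩)
    · rw [hV, Submodule.orthogonal_closure, Submodule.mem_orthogonal]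
      intro u hu
      induction hu using Submodule.span_induction with
      | mem u hu =>
        obtain ⟨z, rfl⟩ := hu
        rw [inner_sub_right, hkk, lp.inner_single_right]
        simp [hk, hsymm z y]
      | zero => simp
      | add u v _ _ hu hv => rw [inner_add_left, hu, hv, add_zero]
      | smul a u _ hu => rw [inner_smul_left, hu, mul_zero]
  rw [hproj]

/-- For a uniformly Lipschitz family the set of vectors where convergence holds is closed, and here
it contains all finite combinations of basis vectors. -/
theorem EllTwo.tendsto_of_tendsto_single {F : Type*} [NormedAddCommGroup F] [NormedSpace ℝ F]
    {A : ℕ → EllTwo →L[ℝ] F} {B : EllTwo →L[ℝ] F} {C : NNReal}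
    (hA : ∀ N, LipschitzWith C (A N))
    (h : ∀ y : ℕ, Tendsto (fun N => A N (lp.single 2 y (1 : ℝ))) atTop
      (𝓝 (B (lp.single 2 y (1 : ℝ))))) (v : EllTwo) :
    Tendsto (fun N => A N v) atTop (𝓝 (B v)) := by
  have hclosed : IsClosed {v : EllTwo | Tendsto (fun N => A N v) atTop (𝓝 (B v))} :=
    (LipschitzWith.uniformEquicontinuous (fun N => ⇑(A N)) C hA).equicontinuous.isClosed_setOfPred_tendsto
      B.continuous
  refine hclosed.mem_of_tendsto (lp.hasSum_single (by simp) v) (Eventually.of_forall fun s => ?_)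
  change Tendsto _ _ _
  simp only [map_sum]
  refine tendsto_finsetSum _ fun i _ => ?_
  have hs : lp.single 2 i (v i) = v i • (lp.single 2 i (1 : ℝ) : EllTwo) := by
    rw [← lp.single_smul]; simp
  rw [hs]
  simp only [map_smul]
  exact (h i).const_smul (v i)

theorem IsProjectionWithKernel.inner_apply_apply {T : EllTwo →L[ℝ] EllTwo} {K : ℕ → ℕ → ℝ}
    (h : IsProjectionWithKernel T K) (x y : ℕ) :
    inner ℝ (T (lp.single 2 x (1 : ℝ))) (T (lp.single 2 y (1 : ℝ))) = K x y := by
  have := h.1.isSelfAdjoint.isSymmetric (lp.single 2 x (1 : ℝ)) (T (lp.single 2 y (1 : ℝ)))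
  simp only [ContinuousLinearMap.coe_coe] at this
  rw [this, lp.inner_single_left]
  have h2 : T (T (lp.single 2 y (1 : ℝ))) = T (lp.single 2 y (1 : ℝ)) :=
    congrArg (fun S : EllTwo →L[ℝ] EllTwo => S (lp.single 2 y (1 : ℝ))) h.1.isIdempotentElem.eq
  rw [h2, h.2]
  simp

/-- Entries give weak convergence on basis vectors. For projections the squared norms of these
images are the diagonal entries, so the norms converge too, and weak convergence with convergence of
norms is strong. -/
theorem IsProjectionWithKernel.tendsto {T : ℕ → EllTwo →L[ℝ] EllTwo} {S : EllTwo →L[ℝ] EllTwo}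
    {K : ℕ → ℕ → ℕ → ℝ} {L : ℕ → ℕ → ℝ} (hT : ∀ N, IsProjectionWithKernel (T N) (K N))
    (hS : IsProjectionWithKernel S L)
    (hK : ∀ x y, Tendsto (fun N => K N x y) atTop (𝓝 (L x y))) (v : EllTwo) :
    Tendsto (fun N => T N v) atTop (𝓝 (S v)) := by
  refine EllTwo.tendsto_of_tendsto_single (C := 1) (fun N => ?_) (fun y => ?_) v
  · refine LipschitzWith.of_dist_le_mul fun u w => ?_
    rw [dist_eq_norm, dist_eq_norm, ← map_sub, NNReal.coe_one, one_mul]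
    exact (hT N).norm_apply_le _
  set e : EllTwo := lp.single 2 y (1 : ℝ) with he
  have hweak : ∀ g : EllTwo, Tendsto (fun N => inner ℝ (T N e) g) atTop (𝓝 (inner ℝ (S e) g)) := by
    refine EllTwo.tendsto_of_tendsto_single (A := fun N => innerSL ℝ (T N e))
      (B := innerSL ℝ (S e)) (C := ‖e‖₊) (fun N => ?_) (fun x => ?_)
    · refine LipschitzWith.of_dist_le_mul fun u w => ?_
      rw [dist_eq_norm, dist_eq_norm, ← map_sub, innerSL_apply_apply]
      exact (norm_inner_le_norm _ _).trans
        (mul_le_mul_of_nonneg_right ((hT N).norm_apply_le _) (norm_nonneg _))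
    · simp only [innerSL_apply_apply, lp.inner_single_right, (hT _).2, hS.2, he]
      simpa using (hK x y)
  rw [tendsto_iff_norm_sub_tendsto_zero]
  have hsq : Tendsto (fun N => ‖T N e - S e‖ ^ 2) atTop (𝓝 0) := by
    have h1 : ∀ N, ‖T N e - S e‖ ^ 2 = K N y y - 2 * inner ℝ (T N e) (S e) + L y y := by
      intro N
      rw [norm_sub_sq_real, ← real_inner_self_eq_norm_sq, ← real_inner_self_eq_norm_sq,
        (hT N).inner_apply_apply, hS.inner_apply_apply]
    simp only [h1]
    have h2 := ((hK y y).sub ((hweak (S e)).const_mul 2)).add_const (L y y)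
    rw [hS.inner_apply_apply] at h2
    convert h2 using 2
    ring
  have := hsq.sqrt
  simpa using this

/-! ### Characterisation of orthogonal polynomials -/

/-- A submodule of the space of polynomials contains the polynomials of degree less than `n` if it
contains monic polynomials of degrees `0, …, n - 1`. -/
theorem Polynomial.mem_of_monic_mem (V : Submodule ℝ (Polynomial ℝ)) (R : ℕ → Polynomial ℝ)
    (hR : ∀ n, (R n).Monic) (hRd : ∀ n, (R n).natDegree = n) (n : ℕ) (h : ∀ j < n, R j ∈ V)
    (p : Polynomial ℝ) (hp : p.degree < n) : p ∈ V := by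
  induction n generalizing p with
  | zero =>
    have : p = 0 := by simpa using hp
    simp [this]
  | succ n ih =>
    have hdeg : (p - p.coeff n • R n).degree < n := by
      rw [Polynomial.degree_lt_iff_coeff_zero]
      intro m hm
      rcases hm.eq_or_lt with rfl | hm
      · have := (hR n).coeff_natDegree
        rw [hRd] at this
        simp [this]
      · have h1 : (R n).coeff m = 0 :=
          Polynomial.coeff_eq_zero_of_natDegree_lt (by rw [hRd]; exact hm)
        have h2 : p.coeff m = 0 :=
          Polynomial.coeff_eq_zero_of_degree_lt (hp.trans_le (by exact_mod_cast hm))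
        simp [h1, h2]
    have h0 := ih (fun j hj => h j (hj.trans n.lt_succ_self)) _ hdeg
    simpa using V.add_mem h0 (V.smul_mem (p.coeff n) (h n n.lt_succ_self))

/-- Orthogonality is tested against an auxiliary monic family `R`, chosen so that the integrals are
explicit. Two monic polynomials of degree `n` differ by lower degree, so `∫ R n * Q n` equals the
squared norm of `Q n`; its being nonzero stands in for infinite support of `μ`. -/
theorem monic_ortho_unique {μ : Measure ℝ}
    (hint : ∀ p : Polynomial ℝ, Integrable (fun t => p.eval t) μ)
    (Q R : ℕ → Polynomial ℝ) (hQ : ∀ n, (Q n).Monic) (hQd : ∀ n, (Q n).natDegree = n)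
    (hR : ∀ n, (R n).Monic) (hRd : ∀ n, (R n).natDegree = n)
    (h0 : ∀ j n, j < n → ∫ t, (R j).eval t * (Q n).eval t ∂μ = 0)
    (h1 : ∀ n, ∫ t, (R n).eval t * (Q n).eval t ∂μ ≠ 0) (n : ℕ) :
    monicOrthoPoly μ n = Q n ∧
    orthoPolyNormSq μ n = ∫ t, (R n).eval t * (Q n).eval t ∂μ ∧
    ∀ m, ∫ t, (Q m).eval t * (Q n).eval t ∂μ =
      if m = n then orthoPolyNormSq μ n else 0 := by
  let l : Polynomial ℝ →ₗ[ℝ] ℝ :=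
    { toFun := fun p => ∫ t, p.eval t ∂μ
      map_add' := fun p q => by
        simp only [Polynomial.eval_add]
        exact integral_add (hint p) (hint q)
      map_smul' := fun a p => by
        simp only [Polynomial.eval_smul, smul_eq_mul, RingHom.id_apply]
        exact integral_const_mul _ _ }
  have hl : ∀ p q, l (p * q) = ∫ t, p.eval t * q.eval t ∂μ := fun p q => by
    simp [l, Polynomial.eval_mul]
  have hlow : ∀ n : ℕ, ∀ p : Polynomial ℝ, p.degree < n → l (p * Q n) = 0 := by
    intro n p hp
    exact Polynomial.mem_of_monic_mem (LinearMap.ker (l ∘ₗ LinearMap.mulRight ℝ (Q n))) R hR hRd n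
      (fun j hj => by simpa [hl] using h0 j n hj) p hp
  have hdegQ : ∀ n, (Q n).degree = n := fun n => by
    rw [Polynomial.degree_eq_natDegree (hQ n).ne_zero, hQd]
  have hdegR : ∀ n, (R n).degree = n := fun n => by
    rw [Polynomial.degree_eq_natDegree (hR n).ne_zero, hRd]
  have hsame : ∀ n, ∀ p : Polynomial ℝ, p.Monic → p.natDegree = n →
      l (p * Q n) = l (R n * Q n) := by
    intro n p hp hpd
    have hlt : (p - R n).degree < n := by
      have hpn : p.degree = n := by rw [Polynomial.degree_eq_natDegree hp.ne_zero, hpd]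
      rw [← hpn]
      exact Polynomial.degree_sub_lt_left (by rw [hpn, hdegR]) hp.ne_zero (by rw [hp, hR n])
    have := hlow n _ hlt
    rw [sub_mul, map_sub] at this
    linarith
  have hne : ∀ m n, m ≠ n → l (Q m * Q n) = 0 := by
    intro m n hmn
    rcases lt_or_gt_of_ne hmn with h | h
    · exact hlow n _ (by rw [hdegQ]; exact_mod_cast h)
    · rw [mul_comm]
      exact hlow m _ (by rw [hdegQ]; exact_mod_cast h)
  have heq : ∀ n, monicOrthoPoly μ n = Q n := by
    intro n
    induction n using Nat.strong_induction_on with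
    | _ n ih =>
      rw [monicOrthoPoly]
      have hsum : ∑ k : Fin n, Polynomial.C ((∫ t, t ^ n * (monicOrthoPoly μ k.1).eval t ∂μ) /
          (∫ t, ((monicOrthoPoly μ k.1).eval t) ^ 2 ∂μ)) * monicOrthoPoly μ k.1 =
          ∑ k : Fin n, Polynomial.C (l (Polynomial.X ^ n * Q k) / l (Q k * Q k)) * Q k := by
        refine Finset.sum_congr rfl fun k _ => ?_
        rw [ih k k.2, hl, hl]
        simp [pow_two]
      rw [hsum]
      set S := ∑ k : Fin n, Polynomial.C (l (Polynomial.X ^ n * Q k) / l (Q k * Q k)) * Q k with hS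
      have hSdeg : S.degree < n := by
        rw [hS, ← Polynomial.mem_degreeLT]
        refine Submodule.sum_mem _ fun k _ => ?_
        rw [Polynomial.mem_degreeLT]
        rw [← Polynomial.smul_eq_C_mul]
        refine (Polynomial.degree_smul_le _ _).trans_lt ?_
        rw [hdegQ]
        exact_mod_cast k.2
      set D := Polynomial.X ^ n - S - Q n with hD
      have hDdeg : D.degree < n := by
        have e1 : (Polynomial.X ^ n - Q n : Polynomial ℝ).degree < n := by
          have := Polynomial.degree_sub_lt_left (p := (Polynomial.X ^ n : Polynomial ℝ)) (q := Q n)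
            (by rw [hdegQ]; simp) (by simp) (by rw [hQ n]; simp)
          simpa using this
        have e2 : D = (Polynomial.X ^ n - Q n) - S := by rw [hD]; ring
        rw [e2]
        exact (Polynomial.degree_sub_le _ _).trans_lt (max_lt e1 hSdeg)
      have hDQ : ∀ k < n, l (D * Q k) = 0 := by
        intro k hk
        have e1 : l (Q n * Q k) = 0 := hne _ _ hk.ne'
        have e2 : l (S * Q k) = l (Polynomial.X ^ n * Q k) := by
          rw [hS, Finset.sum_mul, map_sum, Finset.sum_eq_single ⟨k, hk⟩]
          · rw [mul_assoc, ← Polynomial.smul_eq_C_mul, map_smul, smul_eq_mul]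
            refine div_mul_cancel₀ _ ?_
            rw [hsame k _ (hQ k) (hQd k), hl]
            exact h1 k
          · intro j _ hj
            rw [mul_assoc, ← Polynomial.smul_eq_C_mul, map_smul,
              hne j k (fun h => hj (Fin.ext h)), smul_zero]
          · simp
        rw [hD, sub_mul, sub_mul, map_sub, map_sub, e1, e2]
        ring
      -- If nonzero, `D` made monic has some degree `d < n`; its pairing with `Q d` vanishes by
      -- `hDQ` but equals that of `R d`, which is nonzero.
      have hD0 : D = 0 := by
        by_contra hne0
        have hdn : D.natDegree < n := (Polynomial.natDegree_lt_iff_degree_lt hne0).mpr hDdeg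
        have hlead := Polynomial.leadingCoeff_ne_zero.mpr hne0
        have := hsame D.natDegree (Polynomial.C D.leadingCoeff⁻¹ * D)
          (Polynomial.monic_C_mul_of_mul_leadingCoeff_eq_one (inv_mul_cancel₀ hlead))
          (Polynomial.natDegree_C_mul (inv_ne_zero hlead))
        rw [mul_assoc, ← Polynomial.smul_eq_C_mul, map_smul, hDQ _ hdn, smul_zero, hl] at this
        exact h1 _ this.symm
      exact sub_eq_zero.mp hD0
  have hnorm : ∀ n, orthoPolyNormSq μ n = l (Q n * Q n) := by
    intro n
    rw [orthoPolyNormSq, heq, hl]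
    simp [pow_two]
  refine ⟨heq n, ?_, fun m => ?_⟩
  · rw [hnorm, hsame n _ (hQ n) (hQd n), hl]
  · rw [← hl]
    split_ifs with h
    · rw [h, hnorm]
    · exact hne m n h

/-! ### The common moment computation -/

/-- Up to the sign `(-1) ^ n`, the sum is an `n`-th finite difference of a monic polynomial of
degree `j`. Both Laguerre and Meixner orthogonality reduce to it. -/
theorem sum_choose_ascPochhammer (β : ℝ) (j n : ℕ) (hj : j ≤ n) :
    ∑ k ∈ Finset.range (n + 1), (-1 : ℝ) ^ k * (n.choose k : ℝ) *
      (ascPochhammer ℝ j).eval (β + k) = if j = n then (-1 : ℝ) ^ n * (n.factorial : ℝ) else 0 := by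
  have h1 := fwdDiff_iter_eq_sum_shift (1 : ℝ) (ascPochhammer ℝ j).eval n β
  have h2 : ∑ k ∈ Finset.range (n + 1), (-1 : ℝ) ^ k * (n.choose k : ℝ) *
      (ascPochhammer ℝ j).eval (β + k) =
      (-1 : ℝ) ^ n * (fwdDiff (1 : ℝ))^[n] (ascPochhammer ℝ j).eval β := by
    rw [h1, Finset.mul_sum]
    refine Finset.sum_congr rfl fun k hk => ?_
    have hk' : k ≤ n := Nat.lt_succ_iff.mp (Finset.mem_range.mp hk)
    have : (-1 : ℝ) ^ k = (-1) ^ n * (-1) ^ (n - k) := by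
      rw [← pow_add, show n + (n - k) = k + 2 * (n - k) by omega, pow_add, pow_mul]
      simp
    rw [this]
    simp
    ring
  rw [h2]
  split_ifs with h
  · subst h
    have := Polynomial.fwdDiff_iter_degree_eq_factorial (ascPochhammer ℝ j)
    rw [ascPochhammer_natDegree, (monic_ascPochhammer ℝ j).leadingCoeff] at this
    rw [this]
    simp
  · have := Polynomial.fwdDiff_iter_eq_zero_of_degree_lt (P := ascPochhammer ℝ j) (n := n)
      (by rw [ascPochhammer_natDegree]; omega)
    rw [this]
    simp

theorem ascPochhammer_eval_add (β : ℝ) (m n : ℕ) :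
    (ascPochhammer ℝ (m + n)).eval β =
      (ascPochhammer ℝ m).eval β * (ascPochhammer ℝ n).eval (β + m) := by
  rw [← ascPochhammer_mul]
  simp

theorem Gamma_add_nat_eq (β : ℝ) (hβ : 0 < β) (n : ℕ) :
    Real.Gamma (β + n) = Real.Gamma β * (ascPochhammer ℝ n).eval β := by
  induction n with
  | zero => simp
  | succ n ih =>
    rw [Nat.cast_succ, ← add_assoc, Real.Gamma_add_one (by positivity), ih, ascPochhammer_succ_eval]
    ring

theorem ascPochhammer_eval_ne_zero {β : ℝ} (hβ : 0 < β) (n : ℕ) :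
    (ascPochhammer ℝ n).eval β ≠ 0 := (ascPochhammer_pos n β hβ).ne'

theorem Polynomial.monic_sum_of_monic (B : ℕ → Polynomial ℝ) (hB : ∀ n, (B n).Monic)
    (hBd : ∀ n, (B n).natDegree = n) (a : ℕ → ℝ) (n : ℕ) (ha : a n ≠ 0) :
    (Polynomial.C (a n)⁻¹ * ∑ k ∈ Finset.range (n + 1), Polynomial.C (a k) * B k).Monic ∧
    (Polynomial.C (a n)⁻¹ *
      ∑ k ∈ Finset.range (n + 1), Polynomial.C (a k) * B k).natDegree = n := by
  have hBdeg : ∀ n, (B n).degree = n := fun n => by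
    rw [Polynomial.degree_eq_natDegree (hB n).ne_zero, hBd]
  set S := ∑ k ∈ Finset.range n, (a n)⁻¹ • a k • B k with hS
  have hSdeg : S.degree < (B n).degree := by
    rw [hBdeg, hS, ← Polynomial.mem_degreeLT]
    refine Submodule.sum_mem _ fun k hk => Submodule.smul_mem _ _ (Submodule.smul_mem _ _ ?_)
    rw [Polynomial.mem_degreeLT, hBdeg]
    exact_mod_cast Finset.mem_range.mp hk
  have heq : Polynomial.C (a n)⁻¹ * ∑ k ∈ Finset.range (n + 1), Polynomial.C (a k) * B k =
      S + B n := by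
    rw [Finset.sum_range_succ, mul_add, ← mul_assoc, ← Polynomial.C_mul, inv_mul_cancel₀ ha,
      Polynomial.C_1, one_mul, hS, Finset.mul_sum]
    simp only [Polynomial.smul_eq_C_mul]
  rw [heq]
  exact ⟨(hB n).add_of_right hSdeg, by
    rw [Polynomial.natDegree_add_eq_right_of_degree_lt hSdeg, hBd]⟩

/-! ### Laguerre polynomials -/

/-- The Laguerre polynomial `₁F₁(-n; β; t)`. -/
def laguerrePoly (β : ℝ) (n : ℕ) : Polynomial ℝ :=
  ∑ k ∈ Finset.range (n + 1),
    Polynomial.C ((-1 : ℝ) ^ k * (n.choose k : ℝ) / (ascPochhammer ℝ k).eval β) * Polynomial.X ^ k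

theorem laguerrePoly_eval (β : ℝ) (n : ℕ) (t : ℝ) :
    (laguerrePoly β n).eval t = ∑ k ∈ Finset.range (n + 1),
      (-1 : ℝ) ^ k * (n.choose k : ℝ) / (ascPochhammer ℝ k).eval β * t ^ k := by
  simp [laguerrePoly, Polynomial.eval_finsetSum]

theorem measurable_laguerre_density (β : ℝ) :
    Measurable fun t : ℝ => ENNReal.ofReal (t ^ (β - 1) * Real.exp (-t)) := by
  fun_prop

theorem laguerre_density_nonneg (β : ℝ) {t : ℝ} (ht : t ∈ Set.Ioi (0 : ℝ)) :
    0 ≤ t ^ (β - 1) * Real.exp (-t) :=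
  mul_nonneg (Real.rpow_nonneg (le_of_lt ht) _) (Real.exp_pos _).le

theorem integral_laguerreMeasure (β : ℝ) (f : ℝ → ℝ) :
    ∫ t, f t ∂(laguerreMeasure β) =
      ∫ t in Set.Ioi (0 : ℝ), t ^ (β - 1) * Real.exp (-t) * f t := by
  rw [laguerreMeasure, integral_withDensity_eq_integral_toReal_smul (measurable_laguerre_density β)
    (by simp)]
  refine setIntegral_congr_fun measurableSet_Ioi fun t ht => ?_
  simp only [ENNReal.toReal_ofReal (laguerre_density_nonneg β ht), smul_eq_mul]

theorem integrable_laguerreMeasure_iff (β : ℝ) (f : ℝ → ℝ) :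
    Integrable f (laguerreMeasure β) ↔
      IntegrableOn (fun t => t ^ (β - 1) * Real.exp (-t) * f t) (Set.Ioi 0) := by
  rw [laguerreMeasure, integrable_withDensity_iff_integrable_smul' (measurable_laguerre_density β)
    (by simp)]
  refine integrableOn_congr_fun (fun t ht => ?_) measurableSet_Ioi
  simp only [ENNReal.toReal_ofReal (laguerre_density_nonneg β ht), smul_eq_mul]

theorem laguerre_density_mul_pow (β : ℝ) (n : ℕ) {t : ℝ} (ht : t ∈ Set.Ioi (0 : ℝ)) :
    t ^ (β - 1) * Real.exp (-t) * t ^ n = Real.exp (-t) * t ^ (β + n - 1) := by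
  have h : t ^ (β + n - 1) = t ^ (β - 1) * t ^ n := by
    rw [← Real.rpow_natCast, ← Real.rpow_add ht]
    ring_nf
  rw [h]
  ring

theorem integrable_pow_laguerreMeasure {β : ℝ} (hβ : 0 < β) (n : ℕ) :
    Integrable (fun t : ℝ => t ^ n) (laguerreMeasure β) := by
  rw [integrable_laguerreMeasure_iff]
  have := Real.GammaIntegral_convergent (s := β + n) (by positivity)
  exact this.congr_fun (fun t ht => (laguerre_density_mul_pow β n ht).symm) measurableSet_Ioi

theorem integral_pow_laguerreMeasure {β : ℝ} (hβ : 0 < β) (n : ℕ) :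
    ∫ t, t ^ n ∂(laguerreMeasure β) = Real.Gamma (β + n) := by
  rw [integral_laguerreMeasure, Real.Gamma_eq_integral (by positivity)]
  exact setIntegral_congr_fun measurableSet_Ioi fun t ht => laguerre_density_mul_pow β n ht

theorem integrable_eval_laguerreMeasure {β : ℝ} (hβ : 0 < β) (p : Polynomial ℝ) :
    Integrable (fun t => p.eval t) (laguerreMeasure β) := by
  simp only [Polynomial.eval_eq_sum_range]
  exact integrable_finsetSum _ fun k _ => (integrable_pow_laguerreMeasure hβ k).const_mul _

/-- The moment `Γ(β + k + j)` factors as `Γ(β) (β)_k (β + k)_j`, and `(β)_k` cancels the denominator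
of the `k`-th coefficient. -/
theorem integral_pow_mul_laguerrePoly {β : ℝ} (hβ : 0 < β) (j n : ℕ) (hj : j ≤ n) :
    ∫ t, t ^ j * (laguerrePoly β n).eval t ∂(laguerreMeasure β) =
      if j = n then Real.Gamma β * ((-1 : ℝ) ^ n * (n.factorial : ℝ)) else 0 := by
  have h1 : ∀ t : ℝ, t ^ j * (laguerrePoly β n).eval t = ∑ k ∈ Finset.range (n + 1),
      (-1 : ℝ) ^ k * (n.choose k : ℝ) / (ascPochhammer ℝ k).eval β * t ^ (k + j) := by
    intro t
    rw [laguerrePoly_eval, Finset.mul_sum]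
    refine Finset.sum_congr rfl fun k _ => ?_
    ring
  simp only [h1]
  rw [integral_finsetSum _ fun k _ => (integrable_pow_laguerreMeasure hβ _).const_mul _]
  have h2 := sum_choose_ascPochhammer β j n hj
  have h3 : ∀ k ∈ Finset.range (n + 1), ∫ t, (-1 : ℝ) ^ k * (n.choose k : ℝ) /
      (ascPochhammer ℝ k).eval β * t ^ (k + j) ∂(laguerreMeasure β) =
      Real.Gamma β * ((-1 : ℝ) ^ k * (n.choose k : ℝ) * (ascPochhammer ℝ j).eval (β + k)) := by
    intro k _
    rw [integral_const_mul, integral_pow_laguerreMeasure hβ, Gamma_add_nat_eq β hβ,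
      ascPochhammer_eval_add]
    field_simp [ascPochhammer_eval_ne_zero hβ k]
  rw [Finset.sum_congr rfl h3, ← Finset.mul_sum, h2]
  split_ifs <;> simp

theorem laguerrePoly_monic {β : ℝ} (hβ : 0 < β) (n : ℕ) :
    (Polynomial.C ((-1 : ℝ) ^ n * (ascPochhammer ℝ n).eval β) * laguerrePoly β n).Monic ∧
    (Polynomial.C ((-1 : ℝ) ^ n * (ascPochhammer ℝ n).eval β) *
      laguerrePoly β n).natDegree = n := by
  have hcoef : ((-1 : ℝ) ^ n * (n.choose n : ℝ) / (ascPochhammer ℝ n).eval β)⁻¹ =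
      (-1 : ℝ) ^ n * (ascPochhammer ℝ n).eval β := by
    rw [Nat.choose_self, Nat.cast_one, mul_one, inv_div, div_eq_mul_inv, ← inv_pow, mul_comm]
    norm_num
  have hmon := Polynomial.monic_sum_of_monic (fun k => Polynomial.X ^ k)
    (fun n => Polynomial.monic_X_pow n) (fun n => Polynomial.natDegree_X_pow n)
    (fun k => (-1 : ℝ) ^ k * (n.choose k : ℝ) / (ascPochhammer ℝ k).eval β) n
    (by simp [ascPochhammer_eval_ne_zero hβ n])
  rw [hcoef] at hmon
  exact hmon

theorem laguerre_ortho {β : ℝ} (hβ : 0 < β) (n : ℕ) :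
    monicOrthoPoly (laguerreMeasure β) n =
      Polynomial.C ((-1 : ℝ) ^ n * (ascPochhammer ℝ n).eval β) * laguerrePoly β n ∧
    orthoPolyNormSq (laguerreMeasure β) n =
      Real.Gamma β * (n.factorial : ℝ) * (ascPochhammer ℝ n).eval β ∧
    ∀ m, ∫ t, (monicOrthoPoly (laguerreMeasure β) m).eval t *
      (monicOrthoPoly (laguerreMeasure β) n).eval t ∂(laguerreMeasure β) =
      if m = n then orthoPolyNormSq (laguerreMeasure β) n else 0 := by
  have hmon := fun n => laguerrePoly_monic hβ n
  have hint : ∀ j n : ℕ, j ≤ n → ∫ t, (Polynomial.X ^ j : Polynomial ℝ).eval t *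
      (Polynomial.C ((-1 : ℝ) ^ n * (ascPochhammer ℝ n).eval β) * laguerrePoly β n).eval t
        ∂(laguerreMeasure β) =
      if j = n then Real.Gamma β * (n.factorial : ℝ) * (ascPochhammer ℝ n).eval β else 0 := by
    intro j n hj
    have : ∀ t : ℝ, (Polynomial.X ^ j : Polynomial ℝ).eval t *
      (Polynomial.C ((-1 : ℝ) ^ n * (ascPochhammer ℝ n).eval β) * laguerrePoly β n).eval t =
      ((-1 : ℝ) ^ n * (ascPochhammer ℝ n).eval β) * (t ^ j * (laguerrePoly β n).eval t) := by
      intro t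
      simp
      ring
    simp only [this]
    rw [integral_const_mul, integral_pow_mul_laguerrePoly hβ j n hj]
    split_ifs
    · have h : (-1 : ℝ) ^ n * (-1) ^ n = 1 := by rw [← mul_pow]; simp
      linear_combination (ascPochhammer ℝ n).eval β * Real.Gamma β * (n.factorial : ℝ) * h
    · simp
  have key := monic_ortho_unique (integrable_eval_laguerreMeasure hβ)
    (fun n => Polynomial.C ((-1 : ℝ) ^ n * (ascPochhammer ℝ n).eval β) * laguerrePoly β n)
    (fun n => Polynomial.X ^ n) (fun n => (hmon n).1) (fun n => (hmon n).2)
    (fun n => Polynomial.monic_X_pow n) (fun n => Polynomial.natDegree_X_pow n)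
    (fun j n hj => by rw [hint j n hj.le, if_neg hj.ne])
    (fun n => by
      rw [hint n n le_rfl, if_pos rfl]
      have := Real.Gamma_pos_of_pos hβ
      have := ascPochhammer_pos n β hβ
      positivity)
  refine ⟨(key n).1, ?_, fun m => ?_⟩
  · rw [(key n).2.1, hint n n le_rfl, if_pos rfl]
  · rw [(key m).1, (key n).1]
    exact (key n).2.2 m

/-- The leading coefficient of `₁F₁(-n; β; t)` has sign `(-1) ^ n`; this is where the signs of the
limit kernel arise. -/
theorem orthonormalPoly_laguerre {β : ℝ} (hβ : 0 < β) (n : ℕ) (t : ℝ) :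
    orthonormalPoly (laguerreMeasure β) n t = (-1 : ℝ) ^ n *
      Real.sqrt ((ascPochhammer ℝ n).eval β / (Real.Gamma β * (n.factorial : ℝ))) *
      (laguerrePoly β n).eval t := by
  have hG := Real.Gamma_pos_of_pos hβ
  have ha := ascPochhammer_pos n β hβ
  have hf : (0 : ℝ) < n.factorial := by positivity
  rw [orthonormalPoly, (laguerre_ortho hβ n).1, (laguerre_ortho hβ n).2.1]
  have : (ascPochhammer ℝ n).eval β / Real.sqrt (Real.Gamma β * n.factorial *
      (ascPochhammer ℝ n).eval β) =
      Real.sqrt ((ascPochhammer ℝ n).eval β / (Real.Gamma β * (n.factorial : ℝ))) := by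
    rw [Real.sqrt_mul (by positivity), Real.sqrt_div ha.le]
    nth_rewrite 1 [← Real.mul_self_sqrt ha.le]
    have := Real.sqrt_pos.mpr ha
    field_simp
  rw [← this]
  simp
  ring

theorem integral_orthonormalPoly_laguerre {β : ℝ} (hβ : 0 < β) (m n : ℕ) :
    ∫ t, orthonormalPoly (laguerreMeasure β) m t * orthonormalPoly (laguerreMeasure β) n t
      ∂(laguerreMeasure β) = if m = n then 1 else 0 := by
  have hpos : 0 < orthoPolyNormSq (laguerreMeasure β) n := by
    rw [(laguerre_ortho hβ n).2.1]
    have hG := Real.Gamma_pos_of_pos hβ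
    have ha := ascPochhammer_pos n β hβ
    positivity
  have : ∀ t, orthonormalPoly (laguerreMeasure β) m t * orthonormalPoly (laguerreMeasure β) n t =
      (Real.sqrt (orthoPolyNormSq (laguerreMeasure β) m) *
        Real.sqrt (orthoPolyNormSq (laguerreMeasure β) n))⁻¹ *
      ((monicOrthoPoly (laguerreMeasure β) m).eval t *
        (monicOrthoPoly (laguerreMeasure β) n).eval t) := by
    intro t
    simp only [orthonormalPoly]
    rw [mul_inv]
    ring
  simp only [this]
  rw [integral_const_mul, (laguerre_ortho hβ n).2.2 m]
  split_ifs with h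
  · rw [h, Real.mul_self_sqrt hpos.le, inv_mul_cancel₀ hpos.ne']
  · simp

/-! ### Meixner polynomials -/

theorem HasSum.of_forall_eq {ι α : Type*} [AddCommMonoid α] [TopologicalSpace α] {f g : ι → α}
    {s : α} (h : HasSum f s) (hfg : ∀ x, g x = f x) :
    HasSum g s := (funext hfg : g = f) ▸ h

/-- The Meixner polynomial `₂F₁(-n, -x; β; 1 - 1 / ξ)`. -/
def meixnerPoly (β ξ : ℝ) (n : ℕ) : Polynomial ℝ :=
  ∑ k ∈ Finset.range (n + 1),
    Polynomial.C ((n.choose k : ℝ) * (1 - 1 / ξ) ^ k / (ascPochhammer ℝ k).eval β) *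
      descPochhammer ℝ k

theorem meixnerPoly_eval_nat (β ξ : ℝ) (n x : ℕ) :
    (meixnerPoly β ξ n).eval (x : ℝ) = ∑ k ∈ Finset.range (n + 1),
      (n.choose k : ℝ) * (1 - 1 / ξ) ^ k / (ascPochhammer ℝ k).eval β * (x.descFactorial k : ℝ) := by
  simp [meixnerPoly, Polynomial.eval_finsetSum, descPochhammer_eval_eq_descFactorial]

/-- The self-duality of the Meixner polynomials. -/
theorem meixnerPoly_eval_comm (β ξ : ℝ) (n x : ℕ) :
    (meixnerPoly β ξ n).eval (x : ℝ) = (meixnerPoly β ξ x).eval (n : ℝ) := by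
  have h : ∀ n x : ℕ, (meixnerPoly β ξ n).eval (x : ℝ) = ∑ k ∈ Finset.range (n + x + 1),
      (n.choose k : ℝ) * (1 - 1 / ξ) ^ k / (ascPochhammer ℝ k).eval β *
        (x.descFactorial k : ℝ) := by
    intro n x
    rw [meixnerPoly_eval_nat]
    refine Finset.sum_subset (Finset.range_mono (by omega)) fun k _ hk => ?_
    rw [Nat.choose_eq_zero_of_lt (by simpa using hk)]
    simp
  rw [h, h, add_comm x n]
  refine Finset.sum_congr rfl fun k _ => ?_
  -- Each term carries `k! * choose n k * choose x k`, which is symmetric in `n` and `x`.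
  rw [Nat.descFactorial_eq_factorial_mul_choose, Nat.descFactorial_eq_factorial_mul_choose]
  push_cast
  ring

theorem meixnerWeight_eq {β : ℝ} (hβ : 0 < β) (ξ : ℝ) (x : ℕ) :
    meixnerWeight β ξ x = (ascPochhammer ℝ x).eval β / (x.factorial : ℝ) * ξ ^ x := by
  have := (Real.Gamma_pos_of_pos hβ).ne'
  rw [meixnerWeight, Gamma_add_nat_eq β hβ]
  field_simp

theorem meixnerWeight_pos {β ξ : ℝ} (hβ : 0 < β) (hξ : 0 < ξ) (x : ℕ) :
    0 < meixnerWeight β ξ x := by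
  rw [meixnerWeight_eq hβ]
  have := ascPochhammer_pos x β hβ
  positivity

/-- The negative binomial series. -/
theorem hasSum_meixnerWeight {β ξ : ℝ} (h0 : 0 < ξ) (h1 : ξ < 1) :
    HasSum (fun x : ℕ => (ascPochhammer ℝ x).eval β / (x.factorial : ℝ) * ξ ^ x)
      ((1 - ξ) ^ (-β)) := by
  have h := (Real.one_div_one_sub_rpow_hasFPowerSeriesOnBall_zero β).hasSum (y := ξ)
    (by simp [Metric.mem_eball, edist_dist, abs_of_pos h0, h1])
  rw [zero_add, one_div, ← Real.rpow_neg (by linarith)] at h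
  refine h.of_forall_eq fun x => ?_
  rw [FormalMultilinearSeries.ofScalars_apply_eq]
  have h2 : (ascPochhammer ℝ x).eval β = (x.factorial : ℝ) * Ring.choose (β + x - 1) x := by
    rw [Ring.choose, show β + x - 1 - x + 1 = β by ring, ← Polynomial.ascPochhammer_smeval_eq_eval,
      ← Ring.factorial_nsmul_multichoose_eq_ascPochhammer, nsmul_eq_mul]
  rw [h2, smul_eq_mul]
  have : (x.factorial : ℝ) ≠ 0 := by positivity
  field_simp

/-- The falling factorial kills the terms `x < k` and shifts the index, while `(β + x)_j` raises the
parameter; what remains is the negative binomial series with parameter `β + k + j`. -/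
theorem hasSum_meixnerWeight_mul {β ξ : ℝ} (hβ : 0 < β) (h0 : 0 < ξ) (h1 : ξ < 1) (j k : ℕ) :
    HasSum (fun x : ℕ => meixnerWeight β ξ x *
      ((ascPochhammer ℝ j).eval (β + x) * (x.descFactorial k : ℝ)))
      ((ascPochhammer ℝ (k + j)).eval β * ξ ^ k * (1 - ξ) ^ (-(β + (k + j : ℕ)))) := by
  rw [← hasSum_nat_add_iff' k, Finset.sum_eq_zero, sub_zero]
  · refine ((hasSum_meixnerWeight (β := β + (k + j : ℕ)) h0 h1).mul_left
      ((ascPochhammer ℝ (k + j)).eval β * ξ ^ k)).congr_fun ?_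
    intro y
    rw [meixnerWeight_eq hβ]
    have e1 : ((y + k).descFactorial k : ℝ) * (y.factorial : ℝ) = ((y + k).factorial : ℝ) := by
      have := Nat.factorial_mul_descFactorial (Nat.le_add_left k y)
      rw [Nat.add_sub_cancel] at this
      exact_mod_cast (mul_comm _ _).trans this
    have e2 : (ascPochhammer ℝ (y + k)).eval β * (ascPochhammer ℝ j).eval (β + (y + k : ℕ)) =
        (ascPochhammer ℝ (k + j)).eval β * (ascPochhammer ℝ y).eval (β + (k + j : ℕ)) := by
      rw [← ascPochhammer_eval_add, ← ascPochhammer_eval_add]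
      congr 2
      omega
    have hy : (y.factorial : ℝ) ≠ 0 := by positivity
    have hd : ((y + k).descFactorial k : ℝ) ≠ 0 := by
      intro h
      rw [h, zero_mul] at e1
      exact (by positivity : ((y + k).factorial : ℝ) ≠ 0) e1.symm
    rw [← e1]
    field_simp
    rw [pow_add]
    linear_combination ξ ^ y * ξ ^ k * e2
  · intro i hi
    rw [Nat.descFactorial_of_lt (Finset.mem_range.mp hi)]
    simp

/-- The test polynomial `(β + x)_j`. -/
def shiftedPochhammer (β : ℝ) (j : ℕ) : Polynomial ℝ :=
  (ascPochhammer ℝ j).comp (Polynomial.X + Polynomial.C β)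

theorem shiftedPochhammer_eval (β : ℝ) (j : ℕ) (t : ℝ) :
    (shiftedPochhammer β j).eval t = (ascPochhammer ℝ j).eval (β + t) := by
  simp [shiftedPochhammer, add_comm]

theorem shiftedPochhammer_monic (β : ℝ) (j : ℕ) : (shiftedPochhammer β j).Monic :=
  (monic_ascPochhammer ℝ j).comp_X_add_C β

theorem shiftedPochhammer_natDegree (β : ℝ) (j : ℕ) : (shiftedPochhammer β j).natDegree = j := by
  rw [shiftedPochhammer, Polynomial.natDegree_comp, ascPochhammer_natDegree]
  simp

theorem summable_meixnerWeight_mul_eval {β ξ : ℝ} (hβ : 0 < β) (h0 : 0 < ξ) (h1 : ξ < 1)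
    (p : Polynomial ℝ) : Summable fun x : ℕ => meixnerWeight β ξ x * p.eval (x : ℝ) := by
  let V : Submodule ℝ (Polynomial ℝ) :=
    { carrier := {p | Summable fun x : ℕ => meixnerWeight β ξ x * p.eval (x : ℝ)}
      add_mem' := fun {p q} hp hq => by
        refine (Summable.add hp hq).congr fun x => ?_
        simp [mul_add]
      zero_mem' := by simp [summable_zero]
      smul_mem' := fun a p hp => by
        refine (Summable.mul_left a hp).congr fun x => ?_
        simp
        ring }
  refine Polynomial.mem_of_monic_mem V (shiftedPochhammer β) (shiftedPochhammer_monic β)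
    (shiftedPochhammer_natDegree β) (p.natDegree + 1) (fun j _ => ?_) p
    (Polynomial.degree_le_natDegree.trans_lt (by exact_mod_cast Nat.lt_succ_self _))
  refine (hasSum_meixnerWeight_mul hβ h0 h1 j 0).summable.congr fun x => ?_
  simp [shiftedPochhammer_eval]

theorem integrable_meixnerMeasure_of_summable {β ξ : ℝ} (hβ : 0 < β) (h0 : 0 < ξ) (f : ℝ → ℝ)
    (hf : Summable fun x : ℕ => meixnerWeight β ξ x * f x) :
    Integrable f (meixnerMeasure β ξ) := by
  refine integrable_sum_dirac (by simp) ?_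
  refine hf.abs.congr fun x => ?_
  rw [ENNReal.toReal_ofReal (meixnerWeight_pos hβ h0 x).le, abs_mul,
    abs_of_pos (meixnerWeight_pos hβ h0 x), Real.norm_eq_abs]

theorem integral_meixnerMeasure_of_hasSum {β ξ s : ℝ} (hβ : 0 < β) (h0 : 0 < ξ) (f : ℝ → ℝ)
    (hf : HasSum (fun x : ℕ => meixnerWeight β ξ x * f x) s) :
    ∫ t, f t ∂(meixnerMeasure β ξ) = s := by
  have := hasSum_integral_measure (integrable_meixnerMeasure_of_summable hβ h0 f hf.summable)
  refine this.unique ?_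
  refine hf.of_forall_eq fun x => ?_
  rw [integral_smul_measure, integral_dirac, ENNReal.toReal_ofReal (meixnerWeight_pos hβ h0 x).le,
    smul_eq_mul]

/-- Since `(1 - 1 / ξ) * ξ = -(1 - ξ)`, all `k`-dependent powers of `ξ` and `1 - ξ` cancel, leaving
the same alternating sum as for Laguerre. -/
theorem hasSum_meixnerWeight_mul_meixnerPoly {β ξ : ℝ} (hβ : 0 < β) (h0 : 0 < ξ) (h1 : ξ < 1)
    (j n : ℕ) (hj : j ≤ n) :
    HasSum (fun x : ℕ => meixnerWeight β ξ x *
      ((ascPochhammer ℝ j).eval (β + x) * (meixnerPoly β ξ n).eval (x : ℝ)))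
      (if j = n then (1 - ξ) ^ (-(β + (n : ℝ))) * ((-1 : ℝ) ^ n * (n.factorial : ℝ)) else 0) := by
  have hsum := hasSum_sum (s := Finset.range (n + 1)) fun k _ =>
    (hasSum_meixnerWeight_mul hβ h0 h1 j k).mul_left
      ((n.choose k : ℝ) * (1 - 1 / ξ) ^ k / (ascPochhammer ℝ k).eval β)
  have hval : ∑ k ∈ Finset.range (n + 1),
      (n.choose k : ℝ) * (1 - 1 / ξ) ^ k / (ascPochhammer ℝ k).eval β *
      ((ascPochhammer ℝ (k + j)).eval β * ξ ^ k * (1 - ξ) ^ (-(β + (k + j : ℕ)))) =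
      if j = n then (1 - ξ) ^ (-(β + (n : ℝ))) * ((-1 : ℝ) ^ n * (n.factorial : ℝ)) else 0 := by
    have hterm : ∀ k ∈ Finset.range (n + 1),
        (n.choose k : ℝ) * (1 - 1 / ξ) ^ k / (ascPochhammer ℝ k).eval β *
        ((ascPochhammer ℝ (k + j)).eval β * ξ ^ k * (1 - ξ) ^ (-(β + (k + j : ℕ)))) =
        (1 - ξ) ^ (-(β + (j : ℝ))) *
          ((-1 : ℝ) ^ k * (n.choose k : ℝ) * (ascPochhammer ℝ j).eval (β + k)) := by
      intro k _
      have h1' : 0 < 1 - ξ := by linarith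
      have e1 : (1 - ξ) ^ (-(β + (k + j : ℕ))) = (1 - ξ) ^ (-(β + (j : ℝ))) * ((1 - ξ) ^ k)⁻¹ := by
        rw [← Real.rpow_natCast (1 - ξ) k, ← Real.rpow_neg h1'.le, ← Real.rpow_add h1']
        congr 1
        push_cast
        ring
      have e2 : (1 - 1 / ξ) ^ k * ξ ^ k = (-1) ^ k * (1 - ξ) ^ k := by
        rw [← mul_pow, ← mul_pow]
        congr 1
        field_simp
        ring
      have e3 : (1 - ξ) ^ k ≠ 0 := by positivity
      have e4 := ascPochhammer_eval_ne_zero hβ k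
      rw [e1, ascPochhammer_eval_add]
      calc _ = (n.choose k : ℝ) * ((1 - 1 / ξ) ^ k * ξ ^ k) * ((1 - ξ) ^ k)⁻¹ *
            ((ascPochhammer ℝ k).eval β / (ascPochhammer ℝ k).eval β) *
            (ascPochhammer ℝ j).eval (β + k) * (1 - ξ) ^ (-(β + (j : ℝ))) := by ring
        _ = _ := by
          rw [e2, div_self e4]
          field_simp
    rw [Finset.sum_congr rfl hterm, ← Finset.mul_sum, sum_choose_ascPochhammer β j n hj]
    split_ifs with h
    · rw [h]
    · simp
  rw [hval] at hsum
  refine hsum.of_forall_eq fun x => ?_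
  rw [meixnerPoly_eval_nat, Finset.mul_sum, Finset.mul_sum]
  refine Finset.sum_congr rfl fun k _ => ?_
  ring

theorem meixner_ortho {β ξ : ℝ} (hβ : 0 < β) (h0 : 0 < ξ) (h1 : ξ < 1) (n : ℕ) :
    monicOrthoPoly (meixnerMeasure β ξ) n =
      Polynomial.C ((1 - 1 / ξ) ^ n / (ascPochhammer ℝ n).eval β)⁻¹ * meixnerPoly β ξ n ∧
    orthoPolyNormSq (meixnerMeasure β ξ) n =
      ((1 - 1 / ξ) ^ n / (ascPochhammer ℝ n).eval β)⁻¹ *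
        ((1 - ξ) ^ (-(β + (n : ℝ))) * ((-1 : ℝ) ^ n * (n.factorial : ℝ))) ∧
    ∀ m, ∫ t, (monicOrthoPoly (meixnerMeasure β ξ) m).eval t *
      (monicOrthoPoly (meixnerMeasure β ξ) n).eval t ∂(meixnerMeasure β ξ) =
      if m = n then orthoPolyNormSq (meixnerMeasure β ξ) n else 0 := by
  have hc : 1 - 1 / ξ ≠ 0 := by
    have : 1 < 1 / ξ := by rw [lt_div_iff₀ h0]; linarith
    linarith
  have ha : ∀ n : ℕ, (1 - 1 / ξ) ^ n / (ascPochhammer ℝ n).eval β ≠ 0 := fun n =>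
    div_ne_zero (pow_ne_zero _ hc) (ascPochhammer_eval_ne_zero hβ n)
  have hmon := fun n => Polynomial.monic_sum_of_monic (fun k => descPochhammer ℝ k)
    (fun n => monic_descPochhammer ℝ n) (fun n => descPochhammer_natDegree ℝ n)
    (fun k => (n.choose k : ℝ) * (1 - 1 / ξ) ^ k / (ascPochhammer ℝ k).eval β) n
    (by simpa using ha n)
  simp only [Nat.choose_self, Nat.cast_one, one_mul] at hmon
  set Q : ℕ → Polynomial ℝ := fun n =>
    Polynomial.C ((1 - 1 / ξ) ^ n / (ascPochhammer ℝ n).eval β)⁻¹ * meixnerPoly β ξ n with hQ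
  have hint : ∀ j n : ℕ, j ≤ n → ∫ t, (shiftedPochhammer β j).eval t * (Q n).eval t
        ∂(meixnerMeasure β ξ) =
      ((1 - 1 / ξ) ^ n / (ascPochhammer ℝ n).eval β)⁻¹ *
        (if j = n then (1 - ξ) ^ (-(β + (n : ℝ))) * ((-1 : ℝ) ^ n * (n.factorial : ℝ)) else 0) := by
    intro j n hj
    refine integral_meixnerMeasure_of_hasSum hβ h0 _ ?_
    refine ((hasSum_meixnerWeight_mul_meixnerPoly hβ h0 h1 j n hj).mul_left
      ((1 - 1 / ξ) ^ n / (ascPochhammer ℝ n).eval β)⁻¹).of_forall_eq fun x => ?_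
    rw [shiftedPochhammer_eval, hQ, Polynomial.eval_mul, Polynomial.eval_C]
    ring
  have key := monic_ortho_unique (fun p => integrable_meixnerMeasure_of_summable hβ h0 _
      (summable_meixnerWeight_mul_eval hβ h0 h1 p)) Q
    (shiftedPochhammer β) (fun n => (hmon n).1) (fun n => (hmon n).2)
    (shiftedPochhammer_monic β) (shiftedPochhammer_natDegree β)
    (fun j n hj => by rw [hint j n hj.le, if_neg hj.ne, mul_zero])
    (fun n => by
      rw [hint n n le_rfl, if_pos rfl]
      have h1' : 0 < 1 - ξ := by linarith
      exact mul_ne_zero (inv_ne_zero (ha n)) (mul_ne_zero (Real.rpow_pos_of_pos h1' _).ne'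
        (mul_ne_zero (pow_ne_zero _ (by norm_num)) (by positivity))))
  refine ⟨(key n).1, ?_, fun m => ?_⟩
  · rw [(key n).2.1, hint n n le_rfl, if_pos rfl]
  · rw [(key m).1, (key n).1]
    exact (key n).2.2 m

/-! ### Duality and the Meixner kernel. -/

/-- The squared factor is the monic normalisation. What is left is the reciprocal of the weight at
`n`, the dual orthogonality needed to exchange degree and variable. -/
theorem meixner_normSq {β ξ : ℝ} (hβ : 0 < β) (h0 : 0 < ξ) (h1 : ξ < 1) (n : ℕ) :
    orthoPolyNormSq (meixnerMeasure β ξ) n =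
      (((1 - 1 / ξ) ^ n / (ascPochhammer ℝ n).eval β)⁻¹) ^ 2 /
        ((1 - ξ) ^ β * meixnerWeight β ξ n) := by
  have h1' : 0 < 1 - ξ := by linarith
  have hc : 1 - 1 / ξ ≠ 0 := by
    have : 1 < 1 / ξ := by rw [lt_div_iff₀ h0]; linarith
    linarith
  have e4 := ascPochhammer_eval_ne_zero hβ n
  have hR := Real.rpow_pos_of_pos h1' β
  rw [(meixner_ortho hβ h0 h1 n).2.1, meixnerWeight_eq hβ, neg_add, Real.rpow_add h1',
    Real.rpow_neg h1'.le, Real.rpow_neg h1'.le, Real.rpow_natCast]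
  have e2 : (1 - 1 / ξ) ^ n * ξ ^ n = (-1) ^ n * (1 - ξ) ^ n := by
    rw [← mul_pow, ← mul_pow]
    congr 1
    field_simp
    ring
  have e5 : (-1 : ℝ) ^ n * (-1) ^ n = 1 := by rw [← mul_pow]; simp
  have e6 : (1 - ξ) ^ n ≠ 0 := by positivity
  have e7 : (1 - 1 / ξ) ^ n ≠ 0 := pow_ne_zero _ hc
  have e8 : (n.factorial : ℝ) ≠ 0 := by positivity
  generalize (1 - 1 / ξ) ^ n = c at *
  generalize (1 - ξ) ^ n = d at *
  generalize (-1 : ℝ) ^ n = s at *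
  generalize (ascPochhammer ℝ n).eval β = a at *
  have h9 : ξ ^ n ≠ 0 := by positivity
  generalize ξ ^ n = y at *
  field_simp
  linear_combination s * e2 + d * e5

/-- The monic normalisations cancel between numerator and norm, and self-duality turns the summation
index from a degree into a node. -/
theorem meixnerKernel_eq {β ξ : ℝ} (hβ : 0 < β) (h0 : 0 < ξ) (h1 : ξ < 1) (N x y : ℕ) :
    meixnerKernel N β ξ x y = Real.sqrt (meixnerWeight β ξ x * meixnerWeight β ξ y) *
      ∑ n ∈ Finset.range N, (1 - ξ) ^ β * meixnerWeight β ξ n *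
        ((meixnerPoly β ξ x).eval (n : ℝ) * (meixnerPoly β ξ y).eval (n : ℝ)) := by
  rw [meixnerKernel]
  congr 1
  refine Finset.sum_congr rfl fun n _ => ?_
  have hc : 1 - 1 / ξ ≠ 0 := by
    have : 1 < 1 / ξ := by rw [lt_div_iff₀ h0]; linarith
    linarith
  have ha : (1 - 1 / ξ) ^ n / (ascPochhammer ℝ n).eval β ≠ 0 :=
    div_ne_zero (pow_ne_zero _ hc) (ascPochhammer_eval_ne_zero hβ n)
  have hR := Real.rpow_pos_of_pos (by linarith : 0 < 1 - ξ) β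
  have hw := meixnerWeight_pos hβ h0 n
  rw [(meixner_ortho hβ h0 h1 n).1, meixner_normSq hβ h0 h1, meixnerPoly_eval_comm β ξ x n,
    meixnerPoly_eval_comm β ξ y n]
  simp only [Polynomial.eval_mul, Polynomial.eval_C]
  generalize (1 - 1 / ξ) ^ n / (ascPochhammer ℝ n).eval β = a at *
  field_simp

theorem hasSum_meixner_orthonormal {β ξ : ℝ} (hβ : 0 < β) (h0 : 0 < ξ) (h1 : ξ < 1) (m n : ℕ) :
    HasSum (fun z : ℕ => meixnerWeight β ξ z *
      ((monicOrthoPoly (meixnerMeasure β ξ) m).eval (z : ℝ) *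
        (monicOrthoPoly (meixnerMeasure β ξ) n).eval (z : ℝ)))
      (if m = n then orthoPolyNormSq (meixnerMeasure β ξ) n else 0) := by
  have hs := summable_meixnerWeight_mul_eval hβ h0 h1
    (monicOrthoPoly (meixnerMeasure β ξ) m * monicOrthoPoly (meixnerMeasure β ξ) n)
  have hint := integral_meixnerMeasure_of_hasSum hβ h0 (fun t =>
    (monicOrthoPoly (meixnerMeasure β ξ) m * monicOrthoPoly (meixnerMeasure β ξ) n).eval t) hs.hasSum
  have hsum := hs.hasSum
  rw [← hint] at hsum
  simp only [Polynomial.eval_mul] at hsum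
  rw [(meixner_ortho hβ h0 h1 n).2.2 m] at hsum
  exact hsum

theorem meixnerKernel_symm (β ξ : ℝ) (N x y : ℕ) :
    meixnerKernel N β ξ x y = meixnerKernel N β ξ y x := by
  rw [meixnerKernel, meixnerKernel, mul_comm (meixnerWeight β ξ x)]
  congr 1
  refine Finset.sum_congr rfl fun n _ => ?_
  ring

theorem hasSum_meixnerKernel_mul {β ξ : ℝ} (hβ : 0 < β) (h0 : 0 < ξ) (h1 : ξ < 1) (N x y : ℕ) :
    HasSum (fun z => meixnerKernel N β ξ x z * meixnerKernel N β ξ y z)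
      (meixnerKernel N β ξ x y) := by
  set P : ℕ → ℕ → ℝ := fun n z => (monicOrthoPoly (meixnerMeasure β ξ) n).eval (z : ℝ) with hP
  set S : ℕ → ℝ := orthoPolyNormSq (meixnerMeasure β ξ) with hS
  have hS0 : ∀ n, S n ≠ 0 := by
    intro n
    rw [hS, meixner_normSq hβ h0 h1]
    have hc : 1 - 1 / ξ ≠ 0 := by
      have : 1 < 1 / ξ := by rw [lt_div_iff₀ h0]; linarith
      linarith
    have hR := Real.rpow_pos_of_pos (by linarith : 0 < 1 - ξ) β
    have hw := meixnerWeight_pos hβ h0 n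
    have := ascPochhammer_eval_ne_zero hβ n
    positivity
  have hsum := (hasSum_sum (s := Finset.range N) fun m _ =>
    hasSum_sum (s := Finset.range N) fun n _ =>
      (hasSum_meixner_orthonormal hβ h0 h1 m n).mul_left
        (P m x / S m * (P n y / S n))).mul_left
      (Real.sqrt (meixnerWeight β ξ x) * Real.sqrt (meixnerWeight β ξ y))
  have hwx := fun x => (meixnerWeight_pos hβ h0 x).le
  have hval : meixnerKernel N β ξ x y = Real.sqrt (meixnerWeight β ξ x) *
      Real.sqrt (meixnerWeight β ξ y) * ∑ m ∈ Finset.range N, ∑ n ∈ Finset.range N,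
        P m x / S m * (P n y / S n) * (if m = n then S n else 0) := by
    rw [meixnerKernel, Real.sqrt_mul (hwx x)]
    congr 1
    refine Finset.sum_congr rfl fun m hm => ?_
    rw [Finset.sum_eq_single m]
    · rw [if_pos rfl]
      have := hS0 m
      change P m x * P m y / S m = P m x / S m * (P m y / S m) * S m
      field_simp
    · intro n _ hn
      rw [if_neg hn.symm, mul_zero]
    · intro h
      exact absurd hm h
  rw [hval]
  refine hsum.of_forall_eq fun z => ?_
  rw [meixnerKernel, meixnerKernel, Real.sqrt_mul (hwx x), Real.sqrt_mul (hwx y)]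
  rw [mul_mul_mul_comm, Finset.sum_mul_sum]
  have : Real.sqrt (meixnerWeight β ξ x) * Real.sqrt (meixnerWeight β ξ z) *
      (Real.sqrt (meixnerWeight β ξ y) * Real.sqrt (meixnerWeight β ξ z)) =
      Real.sqrt (meixnerWeight β ξ x) * Real.sqrt (meixnerWeight β ξ y) *
        meixnerWeight β ξ z := by
    linear_combination (Real.sqrt (meixnerWeight β ξ x) * Real.sqrt (meixnerWeight β ξ y)) *
      Real.mul_self_sqrt (hwx z)
  rw [this, mul_assoc, Finset.mul_sum]
  congr 1
  refine Finset.sum_congr rfl fun m _ => ?_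
  rw [Finset.mul_sum]
  refine Finset.sum_congr rfl fun n _ => ?_
  simp only [hP, hS]
  ring

theorem exists_isProjectionWithKernel_meixner {β ξ : ℝ} (hβ : 0 < β) (h0 : 0 < ξ) (h1 : ξ < 1)
    (N : ℕ) : ∃ T : EllTwo →L[ℝ] EllTwo, IsProjectionWithKernel T (meixnerKernel N β ξ) :=
  exists_isProjectionWithKernel _ (meixnerKernel_symm β ξ N) (hasSum_meixnerKernel_mul hβ h0 h1 N)

/-! ### Determinacy under exponential moments -/

theorem hasSum_exp_series (z : ℂ) : HasSum (fun m : ℕ => z ^ m / (m.factorial : ℂ)) (Complex.exp z) := by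
  rw [Complex.exp_eq_exp_ℂ]
  exact NormedSpace.expSeries_div_hasSum_exp z

theorem hasSum_real_exp_series (x : ℝ) :
    HasSum (fun m : ℕ => x ^ m / (m.factorial : ℝ)) (Real.exp x) := by
  rw [Real.exp_eq_exp_ℝ]
  exact NormedSpace.expSeries_div_hasSum_exp x

/-- Vanishing of all moments twisted by frequency `u` propagates to `u + s`: expand the exponential
of `i s t` in its Taylor series and integrate termwise. The bound `|s| ≤ a` lets `exp (a * |t|)`
dominate, with a step size independent of `u`. -/
theorem integral_pow_mul_cexp_add_eq_zero {μ : Measure ℝ} {f : ℝ → ℝ} {a : ℝ}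
    (hf : AEStronglyMeasurable f μ)
    (hexp : ∀ n : ℕ, Integrable (fun t => |t| ^ n * Real.exp (a * |t|) * f t) μ)
    {u s : ℝ} (hs : |s| ≤ a)
    (hu : ∀ n : ℕ, ∫ t, (t : ℂ) ^ n * Complex.exp (u * t * Complex.I) * f t ∂μ = 0) (n : ℕ) :
    ∫ t, (t : ℂ) ^ n * Complex.exp ((u + s : ℝ) * t * Complex.I) * f t ∂μ = 0 := by
  set F : ℕ → ℝ → ℂ := fun m t => (s * Complex.I) ^ m / (m.factorial : ℂ) *
    ((t : ℂ) ^ (n + m) * Complex.exp (u * t * Complex.I) * f t) with hF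
  set b : ℕ → ℝ → ℝ := fun m t => |t| ^ n * |f t| * ((|s| * |t|) ^ m / (m.factorial : ℝ)) with hb
  have hbsum : ∀ t, HasSum (fun m => b m t) (|t| ^ n * |f t| * Real.exp (|s| * |t|)) :=
    fun t => (hasSum_real_exp_series _).mul_left _
  have hfc : AEStronglyMeasurable (fun t => (f t : ℂ)) μ :=
    Complex.continuous_ofReal.comp_aestronglyMeasurable hf
  have hmeas : ∀ k : ℕ, AEStronglyMeasurable
      (fun t : ℝ => (t : ℂ) ^ k * Complex.exp (u * t * Complex.I) * f t) μ := fun k =>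
    AEStronglyMeasurable.mul (by fun_prop) hfc
  have key := hasSum_integral_of_dominated_convergence (μ := μ) (F := F)
    (f := fun t : ℝ => (t : ℂ) ^ n * Complex.exp ((u + s : ℝ) * t * Complex.I) * f t) b
    (fun m => (hmeas _).const_mul _) ?_ (ae_of_all _ fun t => (hbsum t).summable) ?_ ?_
  · have h0 : ∀ m, ∫ t, F m t ∂μ = 0 := fun m => by
      rw [hF, integral_const_mul, hu, mul_zero]
    simp only [h0] at key
    exact key.unique hasSum_zero
  · refine fun m => ae_of_all _ fun t => le_of_eq ?_
    have h1 : ‖Complex.exp (u * t * Complex.I)‖ = 1 := by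
      rw [← Complex.ofReal_mul]
      exact Complex.norm_exp_ofReal_mul_I _
    simp only [hF, hb, norm_mul, norm_div, norm_pow, h1, Complex.norm_real, Complex.norm_I,
      Real.norm_eq_abs, Complex.norm_natCast, mul_pow, pow_add]
    ring
  · simp only [fun t => (hbsum t).tsum_eq]
    refine (hexp n).mono ?_ (ae_of_all _ fun t => ?_)
    · exact ((by fun_prop : AEStronglyMeasurable (fun t : ℝ => |t| ^ n) μ).mul
        (continuous_abs.comp_aestronglyMeasurable hf)).mul (by fun_prop)
    · rw [Real.norm_of_nonneg (by positivity), norm_mul, Real.norm_of_nonneg (by positivity),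
        Real.norm_eq_abs, mul_right_comm]
      gcongr
  · refine ae_of_all _ fun t => ?_
    have h1 : Complex.exp ((u + s : ℝ) * t * Complex.I) =
        Complex.exp (u * t * Complex.I) * Complex.exp (s * Complex.I * t) := by
      rw [← Complex.exp_add]
      congr 1
      push_cast
      ring
    rw [h1]
    have h2 := (hasSum_exp_series (s * Complex.I * t)).mul_left
      ((t : ℂ) ^ n * Complex.exp (u * t * Complex.I) * f t)
    have h3 : (t : ℂ) ^ n * (Complex.exp (u * t * Complex.I) * Complex.exp (s * Complex.I * t)) *
        f t = (t : ℂ) ^ n * Complex.exp (u * t * Complex.I) * f t *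
          Complex.exp (s * Complex.I * t) := by ring
    rw [h3]
    refine h2.of_forall_eq fun m => ?_
    simp only [hF]
    rw [mul_pow _ (t : ℂ), pow_add]
    ring

/-- Finitely many steps of length at most `a` reach any frequency from `0`, so the Fourier transform
of `f` against `μ` vanishes identically. -/
theorem ae_eq_zero_of_integral_pow_mul_eq_zero {μ : Measure ℝ} {f : ℝ → ℝ} {a : ℝ} (ha : 0 < a)
    (hint : Integrable f μ)
    (hexp : ∀ n : ℕ, Integrable (fun t => |t| ^ n * Real.exp (a * |t|) * f t) μ)
    (hmom : ∀ n : ℕ, ∫ t, t ^ n * f t ∂μ = 0) : f =ᵐ[μ] 0 := by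
  have hall : ∀ k : ℕ, ∀ s : ℝ, |s| ≤ a → ∀ n : ℕ,
      ∫ t, (t : ℂ) ^ n * Complex.exp ((k * s : ℝ) * t * Complex.I) * f t ∂μ = 0 := by
    intro k s hs
    induction k with
    | zero =>
      intro n
      have : ∀ t : ℝ, (t : ℂ) ^ n * Complex.exp (((0 : ℕ) * s : ℝ) * t * Complex.I) * f t =
          ((t ^ n * f t : ℝ) : ℂ) := fun t => by simp
      simp only [this]
      rw [integral_complex_ofReal, hmom]
      simp
    | succ k ih =>
      intro n
      rw [Nat.cast_succ, add_one_mul]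
      exact integral_pow_mul_cexp_add_eq_zero hint.aestronglyMeasurable hexp hs ih n
  have hchar : ∀ u : ℝ, ∫ t, Complex.exp (u * t * Complex.I) * f t ∂μ = 0 := by
    intro u
    obtain ⟨k, hk⟩ := exists_nat_gt (|u| / a)
    have hk0 : (0 : ℝ) < k := lt_of_le_of_lt (by positivity) hk
    have hs : |u / k| ≤ a := by
      rw [abs_div, abs_of_pos hk0, div_le_iff₀ hk0, mul_comm]
      exact ((div_lt_iff₀ ha).mp hk).le
    have := hall k (u / k) hs 0
    rw [mul_div_cancel₀ _ hk0.ne'] at this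
    simpa using this
  have hp : AEMeasurable (fun t => ENNReal.ofReal (f t)) μ := hint.aemeasurable.ennreal_ofReal
  have hn : AEMeasurable (fun t => ENNReal.ofReal (-f t)) μ := hint.neg.aemeasurable.ennreal_ofReal
  have hpf : ∫⁻ t, ENNReal.ofReal (f t) ∂μ ≠ ⊤ := hint.lintegral_lt_top.ne
  have hnf : ∫⁻ t, ENNReal.ofReal (-f t) ∂μ ≠ ⊤ := hint.neg.lintegral_lt_top.ne
  have : IsFiniteMeasure (μ.withDensity fun t => ENNReal.ofReal (f t)) :=
    isFiniteMeasure_withDensity hpf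
  have : IsFiniteMeasure (μ.withDensity fun t => ENNReal.ofReal (-f t)) :=
    isFiniteMeasure_withDensity hnf
  have hbd : ∀ u : ℝ, ∀ᵐ t : ℝ ∂μ, ‖Complex.exp (u * t * Complex.I)‖ ≤ 1 := fun u =>
    ae_of_all _ fun t => by
      rw [← Complex.ofReal_mul]
      exact (Complex.norm_exp_ofReal_mul_I _).le
  -- As `f` is signed, injectivity of the characteristic function is applied to the finite measures
  -- with densities the positive and negative parts of `f`.
  have hEq : (μ.withDensity fun t => ENNReal.ofReal (f t)) =
      μ.withDensity fun t => ENNReal.ofReal (-f t) := by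
    refine Measure.ext_of_charFun (funext fun u => ?_)
    rw [charFun_apply_real, charFun_apply_real,
      integral_withDensity_eq_integral_toReal_smul₀ hp (by simp),
      integral_withDensity_eq_integral_toReal_smul₀ hn (by simp), ← sub_eq_zero, ← integral_sub]
    · rw [← hchar u]
      refine integral_congr_ae (ae_of_all _ fun t => ?_)
      simp only [Complex.real_smul, ← sub_mul, ← Complex.ofReal_sub]
      have : (ENNReal.ofReal (f t)).toReal - (ENNReal.ofReal (-f t)).toReal = f t := by
        rw [ENNReal.toReal_ofReal', ENNReal.toReal_ofReal']
        exact max_zero_sub_eq_self (f t)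
      rw [this, mul_comm]
    · exact (integrable_toReal_of_lintegral_ne_top hp hpf).smul_bdd 1 (by fun_prop) (hbd u)
    · exact (integrable_toReal_of_lintegral_ne_top hn hnf).smul_bdd 1 (by fun_prop) (hbd u)
  have h2 := (withDensity_eq_iff hp hn hpf).mp hEq
  filter_upwards [h2] with t ht
  have := congrArg ENNReal.toReal ht
  rw [ENNReal.toReal_ofReal', ENNReal.toReal_ofReal'] at this
  rcases le_total (f t) 0 with h | h
  · rw [max_eq_right h, max_eq_left (by linarith)] at this
    simp only [Pi.zero_apply]
    linarith
  · rw [max_eq_left h, max_eq_right (by linarith)] at this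
    exact this

/-! ### The Laguerre polynomials form a Hilbert basis -/

theorem memLp_pow_mul_exp_laguerreMeasure {β : ℝ} (hβ : 0 < β) (n : ℕ) :
    MemLp (fun t : ℝ => |t| ^ n * Real.exp (1 / 4 * |t|)) 2 (laguerreMeasure β) := by
  -- Squaring doubles the rate `1 / 4` to `1 / 2`, so the Laguerre weight still leaves the decay
  -- `exp (-t / 2)`.
  rw [memLp_two_iff_integrable_sq (by fun_prop), integrable_laguerreMeasure_iff]
  have := integrableOn_rpow_mul_exp_neg_mul_rpow (p := 1) (s := β - 1 + 2 * n) (b := 1 / 2)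
    (by have : (0 : ℝ) ≤ n := by positivity
        linarith) one_pos (by norm_num)
  refine this.congr_fun (fun t ht => ?_) measurableSet_Ioi
  have ht' : (0 : ℝ) < t := ht
  simp only [abs_of_pos ht', Real.rpow_one]
  rw [Real.rpow_add ht', show (2 * n : ℝ) = ((2 * n : ℕ) : ℝ) by push_cast; ring, Real.rpow_natCast,
    mul_pow, ← Real.exp_nat_mul, ← pow_mul,
    show t ^ (β - 1) * Real.exp (-t) * (t ^ (n * 2) * Real.exp ((2 : ℕ) * (1 / 4 * t))) =
      t ^ (β - 1) * t ^ (n * 2) * (Real.exp (-t) * Real.exp ((2 : ℕ) * (1 / 4 * t))) by ring,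
    ← Real.exp_add, mul_comm 2 n]
  congr 2
  push_cast
  ring

theorem memLp_eval_laguerreMeasure {β : ℝ} (hβ : 0 < β) (p : Polynomial ℝ) :
    MemLp (fun t => p.eval t) 2 (laguerreMeasure β) := by
  rw [memLp_two_iff_integrable_sq p.continuous.aestronglyMeasurable]
  have := integrable_eval_laguerreMeasure hβ (p ^ 2)
  simp only [Polynomial.eval_pow] at this
  exact this

theorem orthonormalPoly_eq_eval (μ : Measure ℝ) (n : ℕ) (t : ℝ) : orthonormalPoly μ n t =
    ((Real.sqrt (orthoPolyNormSq μ n))⁻¹ • monicOrthoPoly μ n).eval t := by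
  rw [orthonormalPoly, Polynomial.eval_smul, smul_eq_mul, div_eq_inv_mul]

theorem memLp_orthonormalPoly_laguerre {β : ℝ} (hβ : 0 < β) (n : ℕ) :
    MemLp (orthonormalPoly (laguerreMeasure β) n) 2 (laguerreMeasure β) := by
  rw [funext (orthonormalPoly_eq_eval (laguerreMeasure β) n)]
  exact memLp_eval_laguerreMeasure hβ _

theorem inner_toLp_eq_integral {μ : Measure ℝ} {f g : ℝ → ℝ} (hf : MemLp f 2 μ) (hg : MemLp g 2 μ) :
    inner ℝ (hf.toLp f) (hg.toLp g) = ∫ t, f t * g t ∂μ := by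
  rw [L2.inner_def]
  refine integral_congr_ae ?_
  filter_upwards [hf.coeFn_toLp, hg.coeFn_toLp] with t h1 h2
  rw [h1, h2]
  simp [mul_comm]

theorem ae_eq_zero_of_integral_orthonormalPoly_laguerre {β : ℝ} (hβ : 0 < β) {g : ℝ → ℝ}
    (hg : MemLp g 2 (laguerreMeasure β))
    (h : ∀ n, ∫ t, orthonormalPoly (laguerreMeasure β) n t * g t ∂(laguerreMeasure β) = 0) :
    g =ᵐ[laguerreMeasure β] 0 := by
  have hint : ∀ p : Polynomial ℝ, Integrable (fun t => p.eval t * g t) (laguerreMeasure β) :=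
    fun p => (memLp_eval_laguerreMeasure hβ p).integrable_mul hg
  let V : Submodule ℝ (Polynomial ℝ) :=
    { carrier := {p | ∫ t, p.eval t * g t ∂(laguerreMeasure β) = 0}
      add_mem' := fun {p q} hp hq => by
        simp only [Set.mem_ofPred_eq, Polynomial.eval_add, add_mul] at hp hq ⊢
        rw [integral_add (hint p) (hint q), hp, hq, add_zero]
      zero_mem' := by simp
      smul_mem' := fun a p hp => by
        simp only [Set.mem_ofPred_eq, Polynomial.eval_smul, smul_eq_mul, mul_assoc] at hp ⊢
        rw [integral_const_mul, hp, mul_zero] }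
  have hdeg : ∀ n, (monicOrthoPoly (laguerreMeasure β) n).Monic ∧
      (monicOrthoPoly (laguerreMeasure β) n).natDegree = n := by
    intro n
    rw [(laguerre_ortho hβ n).1]
    exact laguerrePoly_monic hβ n
  have hV : ∀ n, monicOrthoPoly (laguerreMeasure β) n ∈ V := by
    intro n
    have h0 := h n
    have hpos : 0 < orthoPolyNormSq (laguerreMeasure β) n := by
      rw [(laguerre_ortho hβ n).2.1]
      have hG := Real.Gamma_pos_of_pos hβ
      have ha := ascPochhammer_pos n β hβ
      positivity
    simp only [orthonormalPoly_eq_eval, Polynomial.eval_smul, smul_eq_mul, mul_assoc] at h0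
    rw [integral_const_mul] at h0
    exact (mul_eq_zero.mp h0).resolve_left (inv_ne_zero (Real.sqrt_pos.mpr hpos).ne')
  refine ae_eq_zero_of_integral_pow_mul_eq_zero (a := 1 / 4) (by norm_num) ?_ ?_ ?_
  · simpa using hint 1
  · exact fun n => (memLp_pow_mul_exp_laguerreMeasure hβ n).integrable_mul hg
  · intro n
    have := Polynomial.mem_of_monic_mem V _ (fun n => (hdeg n).1) (fun n => (hdeg n).2) (n + 1)
      (fun j _ => hV j) (Polynomial.X ^ n) (by
        rw [Polynomial.degree_X_pow]
        exact_mod_cast n.lt_succ_self)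
    simpa [V] using this

theorem exists_hilbertBasis_laguerre {β : ℝ} (hβ : 0 < β) :
    ∃ b : HilbertBasis ℕ ℝ (Lp ℝ 2 (laguerreMeasure β)),
      ∀ n, b n = (memLp_orthonormalPoly_laguerre hβ n).toLp _ := by
  set v : ℕ → Lp ℝ 2 (laguerreMeasure β) := fun n =>
    (memLp_orthonormalPoly_laguerre hβ n).toLp _ with hv
  have hon : Orthonormal ℝ v := by
    rw [orthonormal_iff_ite]
    intro i j
    rw [hv, inner_toLp_eq_integral, integral_orthonormalPoly_laguerre hβ]
  have hbot : (Submodule.span ℝ (Set.range v))ᗮ = ⊥ := by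
    rw [Submodule.eq_bot_iff]
    intro g hg
    rw [Lp.eq_zero_iff_ae_eq_zero]
    refine ae_eq_zero_of_integral_orthonormalPoly_laguerre hβ (Lp.memLp g) fun n => ?_
    rw [← inner_toLp_eq_integral (memLp_orthonormalPoly_laguerre hβ n) (Lp.memLp g), Lp.toLp_coeFn]
    exact Submodule.mem_orthogonal _ _ |>.mp hg _ (Submodule.subset_span ⟨n, rfl⟩)
  exact ⟨HilbertBasis.mkOfOrthogonalEqBot hon hbot, fun n => by
    rw [HilbertBasis.coe_mkOfOrthogonalEqBot]⟩

theorem discreteLaguerreKernelMinus_symm (r β : ℝ) (x y : ℕ) :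
    discreteLaguerreKernelMinus r β x y = discreteLaguerreKernelMinus r β y x := by
  simp only [discreteLaguerreKernelMinus, mul_comm]

/-- Parseval's identity for the orthonormal polynomials of degrees `x` and `y`, both cut off to `t <
r`; the cut-off is idempotent, so their scalar product is again the kernel. -/
theorem hasSum_discreteLaguerreKernelMinus_mul {β : ℝ} (hβ : 0 < β) (r : ℝ) (x y : ℕ) :
    HasSum (fun z => discreteLaguerreKernelMinus r β x z * discreteLaguerreKernelMinus r β y z)
      (discreteLaguerreKernelMinus r β x y) := by
  obtain ⟨b, hb⟩ := exists_hilbertBasis_laguerre hβ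
  have hmem : ∀ n, MemLp ((Set.Iio r).indicator (orthonormalPoly (laguerreMeasure β) n)) 2
      (laguerreMeasure β) := fun n => (memLp_orthonormalPoly_laguerre hβ n).indicator measurableSet_Iio
  have h1 : ∀ x z, inner ℝ ((hmem x).toLp _) (b z) = discreteLaguerreKernelMinus r β x z := by
    intro x z
    rw [hb, inner_toLp_eq_integral, discreteLaguerreKernelMinus, ← integral_indicator measurableSet_Iio]
    refine integral_congr_ae (ae_of_all _ fun t => ?_)
    by_cases ht : t ∈ Set.Iio r <;> simp [ht]
  have h2 : inner ℝ ((hmem x).toLp _) ((hmem y).toLp _) = discreteLaguerreKernelMinus r β x y := by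
    rw [inner_toLp_eq_integral, discreteLaguerreKernelMinus, ← integral_indicator measurableSet_Iio]
    refine integral_congr_ae (ae_of_all _ fun t => ?_)
    by_cases ht : t ∈ Set.Iio r <;> simp [ht]
  have := b.hasSum_inner_mul_inner ((hmem x).toLp _) ((hmem y).toLp _)
  rw [h2] at this
  refine this.of_forall_eq fun z => ?_
  rw [h1, real_inner_comm, h1]

theorem exists_isProjectionWithKernel_discreteLaguerre {β : ℝ} (hβ : 0 < β) (r : ℝ) :
    ∃ S : EllTwo →L[ℝ] EllTwo, IsProjectionWithKernel S
      (fun x y => (-1 : ℝ) ^ (x + y) * discreteLaguerreKernelMinus r β x y) := by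
  refine exists_isProjectionWithKernel _ (fun x y => ?_) fun x y => ?_
  · rw [add_comm, discreteLaguerreKernelMinus_symm]
  · refine ((hasSum_discreteLaguerreKernelMinus_mul hβ r x y).mul_left
      ((-1 : ℝ) ^ (x + y))).of_forall_eq fun z => ?_
    have h : (-1 : ℝ) ^ z * (-1) ^ z = 1 := by rw [← mul_pow]; simp
    rw [pow_add, pow_add, pow_add]
    linear_combination (-1 : ℝ) ^ x * (-1) ^ y * discreteLaguerreKernelMinus r β x z *
      discreteLaguerreKernelMinus r β y z * h

/-! ### Convergence of the Meixner kernels -/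

theorem prod_range_add_eq_ascPochhammer (β : ℝ) (n : ℕ) :
    ∏ j ∈ Finset.range n, (β + j) = (ascPochhammer ℝ n).eval β := by
  induction n with
  | zero => simp
  | succ n ih => rw [Finset.prod_range_succ, ih, ascPochhammer_succ_eval]

/-- Euler's limit formula for Gamma, inverted. Using `n + 1` in place of `n` keeps the power
meaningful at `n = 0`, so that the bound below is uniform in `n`. -/
theorem tendsto_ascPochhammer_div_factorial {β : ℝ} (hβ : 0 < β) :
    Tendsto (fun n : ℕ => (ascPochhammer ℝ n).eval β / (n.factorial : ℝ) * ((n : ℝ) + 1) ^ (1 - β))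
      atTop (𝓝 (Real.Gamma β)⁻¹) := by
  have h1 := (Real.GammaSeq_tendsto_Gamma β).inv₀ (Real.Gamma_pos_of_pos hβ).ne'
  have h2 : Tendsto (fun n : ℕ => ((n : ℝ) / ((n : ℝ) + 1)) ^ β) atTop (𝓝 1) := by
    simpa using tendsto_natCast_div_add_atTop (1 : ℝ) |>.rpow_const (p := β) (Or.inl one_ne_zero)
  have h3 : Tendsto (fun n : ℕ => ((n : ℝ) + 1) / ((n : ℝ) + β)) atTop (𝓝 1) := by
    have ha := tendsto_natCast_div_add_atTop β
    have hb := (tendsto_natCast_div_add_atTop (1 : ℝ)).inv₀ one_ne_zero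
    rw [inv_one] at hb
    have := ha.mul hb
    rw [one_mul] at this
    refine this.congr' ?_
    filter_upwards [eventually_gt_atTop 0] with n hn
    have : (0 : ℝ) < n := by exact_mod_cast hn
    field_simp
  have h := (h2.mul h3).mul h1
  rw [one_mul, one_mul] at h
  refine h.congr' ?_
  filter_upwards [eventually_gt_atTop 0] with n hn
  have hn' : (0 : ℝ) < n := by exact_mod_cast hn
  have hprod : ∏ j ∈ Finset.range (n + 1), (β + j) = (ascPochhammer ℝ n).eval β * (β + n) := by
    rw [← ascPochhammer_succ_eval, prod_range_add_eq_ascPochhammer]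
  have ha := ascPochhammer_pos n β hβ
  rw [Real.GammaSeq, hprod, Real.div_rpow hn'.le (by positivity), Real.rpow_sub (by positivity),
    Real.rpow_one]
  have e1 : 0 < (n : ℝ) ^ β := Real.rpow_pos_of_pos hn' _
  have e2 : 0 < ((n : ℝ) + 1) ^ β := Real.rpow_pos_of_pos (by positivity) _
  have e3 : (0 : ℝ) < n.factorial := by positivity
  field_simp
  ring

theorem exists_ascPochhammer_div_factorial_le {β : ℝ} (hβ : 0 < β) : ∃ C : ℝ, 0 ≤ C ∧ ∀ n : ℕ,
    (ascPochhammer ℝ n).eval β / (n.factorial : ℝ) * ((n : ℝ) + 1) ^ (1 - β) ≤ C := by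
  obtain ⟨C, hC⟩ := (tendsto_ascPochhammer_div_factorial hβ).bddAbove_range
  exact ⟨max C 0, le_max_right _ _, fun n => (hC ⟨n, rfl⟩).trans (le_max_left _ _)⟩

/-- One factor `1 - ξ` of `(1 - ξ) ^ β` is set aside as the mesh. The remainder splits into factors
that, at `n ≈ t / (1 - ξ)`, tend to `1 / Γ(β)`, `t ^ (β - 1)` and `exp (-t)`. -/
theorem rpow_mul_meixnerWeight {β ξ : ℝ} (hβ : 0 < β) (h1 : ξ < 1) (n : ℕ) :
    (1 - ξ) ^ (β - 1) * meixnerWeight β ξ n =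
      (ascPochhammer ℝ n).eval β / (n.factorial : ℝ) * ((n : ℝ) + 1) ^ (1 - β) *
        ((1 - ξ) * ((n : ℝ) + 1)) ^ (β - 1) * ξ ^ n := by
  have h1' : 0 < 1 - ξ := by linarith
  have hn : (0 : ℝ) < (n : ℝ) + 1 := by positivity
  have : ((n : ℝ) + 1) ^ (1 - β) * ((n : ℝ) + 1) ^ (β - 1) = 1 := by
    rw [← Real.rpow_add hn]
    simp
  rw [meixnerWeight_eq hβ, Real.mul_rpow h1'.le hn.le]
  linear_combination -(1 - ξ) ^ (β - 1) * ((ascPochhammer ℝ n).eval β / (n.factorial : ℝ)) *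
    ξ ^ n * this

/-- Rewrites a Riemann sum as the integral of a step function, so that dominated convergence
applies. -/
theorem sum_mul_eq_setIntegral {δ : ℝ} (hδ : 0 < δ) (a : ℕ → ℝ) (N : ℕ) :
    ∑ n ∈ Finset.range N, δ * a n = ∫ t in Set.Ioo 0 (N * δ), a ⌊t / δ⌋₊ := by
  have hpt : ∀ n : ℕ, ∀ t ∈ Set.Ioo ((n : ℝ) * δ) (((n + 1 : ℕ) : ℝ) * δ), a ⌊t / δ⌋₊ = a n := by
    intro n t ht
    congr 1
    have h0 : (n : ℝ) ≤ t / δ := (le_div_iff₀ hδ).mpr ht.1.le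
    rw [Nat.floor_eq_iff (n.cast_nonneg.trans h0)]
    refine ⟨h0, (div_lt_iff₀ hδ).mpr ?_⟩
    have := ht.2
    push_cast at this
    exact this
  have hle : ∀ n : ℕ, (n : ℝ) * δ ≤ ((n + 1 : ℕ) : ℝ) * δ := fun n => by
    push_cast
    linarith
  have hint : ∀ n : ℕ, IntervalIntegrable (fun t => a ⌊t / δ⌋₊) volume ((n : ℝ) * δ)
      (((n + 1 : ℕ) : ℝ) * δ) := by
    intro n
    rw [intervalIntegrable_iff_integrableOn_Ioo_of_le (hle n)]
    have : IntegrableOn (fun _ : ℝ => a n) (Set.Ioo ((n : ℝ) * δ) (((n + 1 : ℕ) : ℝ) * δ)) :=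
      integrableOn_const (by simp)
    exact this.congr_fun (fun t ht => (hpt n t ht).symm) measurableSet_Ioo
  have hval : ∀ n : ℕ, ∫ t in ((n : ℝ) * δ)..(((n + 1 : ℕ) : ℝ) * δ), a ⌊t / δ⌋₊ = δ * a n := by
    intro n
    rw [intervalIntegral.integral_of_le (hle n), integral_Ioc_eq_integral_Ioo,
      setIntegral_congr_fun measurableSet_Ioo (hpt n)]
    rw [setIntegral_const, measureReal_def, Real.volume_Ioo, ENNReal.toReal_ofReal (by linarith [hle n])]
    push_cast
    rw [smul_eq_mul]
    ring
  have := intervalIntegral.sum_integral_adjacent_intervals (μ := volume) (n := N)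
    (f := fun t => a ⌊t / δ⌋₊) (a := fun n : ℕ => (n : ℝ) * δ) (fun k _ => hint k)
  simp only [hval] at this
  rw [this, Nat.cast_zero, zero_mul, intervalIntegral.integral_of_le (by positivity),
    integral_Ioc_eq_integral_Ioo]

theorem tendsto_mul_floor_div {δ : ℕ → ℝ} (hδ0 : ∀ᶠ N in atTop, 0 < δ N)
    (hδ : Tendsto δ atTop (𝓝 0)) {t : ℝ} (ht : 0 < t) :
    Tendsto (fun N => δ N * (⌊t / δ N⌋₊ : ℝ)) atTop (𝓝 t) := by
  have hl : Tendsto (fun N => t - δ N) atTop (𝓝 t) := by simpa using hδ.const_sub t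
  refine tendsto_of_tendsto_of_tendsto_of_le_of_le' hl tendsto_const_nhds ?_ ?_
  · filter_upwards [hδ0] with N hN
    have := (Nat.lt_floor_add_one (t / δ N)).le
    rw [div_le_iff₀ hN] at this
    linarith
  · filter_upwards [hδ0] with N hN
    have := Nat.floor_le (by positivity : 0 ≤ t / δ N)
    rw [le_div_iff₀ hN] at this
    linarith

/-- The `k`-th term contains `(1 - 1 / ξ) ^ k` times a falling factorial of `n`; distributing one `1
- ξ` to each of the `k` factors gives `(-1) ^ k * ξ⁻¹ ^ k * ∏ ((1 - ξ) * n - (1 - ξ) * i)`. -/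
theorem tendsto_meixnerPoly_eval (β : ℝ) {ξ : ℕ → ℝ} (hξ0 : ∀ᶠ N in atTop, 0 < ξ N)
    (hξ : Tendsto ξ atTop (𝓝 1)) {n : ℕ → ℕ} {t : ℝ}
    (hn : Tendsto (fun N => (1 - ξ N) * (n N : ℝ)) atTop (𝓝 t)) (x : ℕ) :
    Tendsto (fun N => (meixnerPoly β (ξ N) x).eval (n N : ℝ)) atTop
      (𝓝 ((laguerrePoly β x).eval t)) := by
  simp only [laguerrePoly_eval, meixnerPoly, Polynomial.eval_finsetSum, Polynomial.eval_mul,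
    Polynomial.eval_C]
  refine tendsto_finsetSum _ fun k _ => ?_
  have h1 : Tendsto (fun N => (x.choose k : ℝ) * (-1) ^ k / (ascPochhammer ℝ k).eval β *
      ((ξ N)⁻¹ ^ k * ∏ i ∈ Finset.range k, ((1 - ξ N) * (n N : ℝ) - (1 - ξ N) * i))) atTop
      (𝓝 ((-1 : ℝ) ^ k * (x.choose k : ℝ) / (ascPochhammer ℝ k).eval β * t ^ k)) := by
    have hp : Tendsto (fun N => ∏ i ∈ Finset.range k, ((1 - ξ N) * (n N : ℝ) - (1 - ξ N) * i))
        atTop (𝓝 (∏ i ∈ Finset.range k, (t - (1 - 1) * i))) :=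
      tendsto_finsetProd _ fun i _ => hn.sub ((hξ.const_sub 1).mul_const _)
    have hi := (hξ.inv₀ one_ne_zero).pow k
    have := (hi.mul hp).const_mul ((x.choose k : ℝ) * (-1) ^ k / (ascPochhammer ℝ k).eval β)
    convert this using 2
    simp only [sub_self, zero_mul, sub_zero, Finset.prod_const, Finset.card_range, inv_one, one_pow,
      one_mul]
    ring
  refine h1.congr' ?_
  filter_upwards [hξ0] with N hN
  rw [descPochhammer_eval_eq_prod_range]
  have e1 : ∏ i ∈ Finset.range k, ((1 - ξ N) * (n N : ℝ) - (1 - ξ N) * i) =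
      (1 - ξ N) ^ k * ∏ i ∈ Finset.range k, ((n N : ℝ) - i) := by
    simp only [← mul_sub]
    rw [Finset.prod_mul_distrib, Finset.prod_const, Finset.card_range]
  have e2 : (1 - 1 / ξ N) ^ k = (-1) ^ k * ((ξ N)⁻¹ ^ k * (1 - ξ N) ^ k) := by
    rw [← mul_pow, ← mul_pow]
    congr 1
    field_simp
    ring
  rw [e1, e2]
  ring

theorem abs_meixnerPoly_eval_le {β ξ R : ℝ} (hβ : 0 < β) (h0 : 1 / 2 ≤ ξ) (h1 : ξ < 1) {n : ℕ}
    (hR : (1 - ξ) * n ≤ R) (x : ℕ) :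
    |(meixnerPoly β ξ x).eval (n : ℝ)| ≤ ∑ k ∈ Finset.range (x + 1),
      (x.choose k : ℝ) / (ascPochhammer ℝ k).eval β * (2 * R) ^ k := by
  rw [meixnerPoly_eval_nat]
  refine (Finset.abs_sum_le_sum_abs _ _).trans (Finset.sum_le_sum fun k _ => ?_)
  have ha := ascPochhammer_pos k β hβ
  have hξ : 0 < ξ := by linarith
  have h1' : 0 < 1 - ξ := by linarith
  -- The constant `2` comes from `ξ ≥ 1 / 2`.
  have e1 : |1 - 1 / ξ| ≤ 2 * (1 - ξ) := by
    have : 1 - 1 / ξ = -((1 - ξ) / ξ) := by field_simp; ring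
    rw [this, abs_neg, abs_of_nonneg (by positivity), div_le_iff₀ hξ]
    nlinarith
  have e2 : (n.descFactorial k : ℝ) ≤ (n : ℝ) ^ k := by exact_mod_cast Nat.descFactorial_le_pow n k
  rw [abs_mul, abs_div, abs_mul, abs_of_pos ha, Nat.abs_cast, Nat.abs_cast, abs_pow]
  calc (x.choose k : ℝ) * |1 - 1 / ξ| ^ k / (ascPochhammer ℝ k).eval β * (n.descFactorial k : ℝ)
      ≤ (x.choose k : ℝ) * (2 * (1 - ξ)) ^ k / (ascPochhammer ℝ k).eval β * (n : ℝ) ^ k := by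
        gcongr
    _ = (x.choose k : ℝ) / (ascPochhammer ℝ k).eval β * (2 * ((1 - ξ) * n)) ^ k := by
        rw [← mul_assoc, mul_pow _ (n : ℝ)]
        ring
    _ ≤ _ := by gcongr

/-- Write `ξ ^ n` as the exponential of `-(log ξ / (ξ - 1)) * ((1 - ξ) * n)`; the quotient is a
slope of `log` at `1` and tends to `1`. -/
theorem tendsto_pow_exp_neg {ξ : ℕ → ℝ} (hξ0 : ∀ᶠ N in atTop, 0 < ξ N ∧ ξ N < 1)
    (hξ : Tendsto ξ atTop (𝓝 1)) {n : ℕ → ℕ} {t : ℝ}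
    (hn : Tendsto (fun N => (1 - ξ N) * (n N : ℝ)) atTop (𝓝 t)) :
    Tendsto (fun N => ξ N ^ n N) atTop (𝓝 (Real.exp (-t))) := by
  have hlog : Tendsto (fun N => Real.log (ξ N) / (ξ N - 1)) atTop (𝓝 1) := by
    have h := (Real.hasDerivAt_log one_ne_zero).tendsto_slope
    simp only [inv_one] at h
    have h2 : Tendsto ξ atTop (𝓝[≠] 1) :=
      tendsto_nhdsWithin_iff.mpr ⟨hξ, hξ0.mono fun N hN => hN.2.ne⟩
    refine (h.comp h2).congr fun N => ?_
    simp [slope_def_field]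
  have h3 := (Real.continuous_exp.tendsto _).comp ((hlog.mul hn).neg)
  rw [one_mul] at h3
  refine h3.congr' ?_
  filter_upwards [hξ0] with N hN
  have h4 : ξ N - 1 ≠ 0 := by linarith [hN.2]
  rw [Function.comp_apply, ← Real.exp_log hN.1, ← Real.exp_nat_mul, Real.exp_log hN.1]
  congr 1
  field_simp
  ring

theorem discreteLaguerreKernelMinus_eq {β r : ℝ} (hβ : 0 < β) (x y : ℕ) :
    (-1 : ℝ) ^ (x + y) * discreteLaguerreKernelMinus r β x y =
      Real.sqrt ((ascPochhammer ℝ x).eval β / (x.factorial : ℝ) *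
        ((ascPochhammer ℝ y).eval β / (y.factorial : ℝ))) *
      ∫ t in Set.Ioo 0 r, (Real.Gamma β)⁻¹ * t ^ (β - 1) * Real.exp (-t) *
        ((laguerrePoly β x).eval t * (laguerrePoly β y).eval t) := by
  have hG := Real.Gamma_pos_of_pos hβ
  have hax := ascPochhammer_pos x β hβ
  have hay := ascPochhammer_pos y β hβ
  rw [discreteLaguerreKernelMinus, ← integral_indicator measurableSet_Iio, integral_laguerreMeasure]
  have h1 : ∀ t : ℝ, t ^ (β - 1) * Real.exp (-t) * (Set.Iio r).indicator
      (fun t => orthonormalPoly (laguerreMeasure β) x t * orthonormalPoly (laguerreMeasure β) y t) t =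
      (Set.Iio r).indicator (fun t => t ^ (β - 1) * Real.exp (-t) *
        (orthonormalPoly (laguerreMeasure β) x t * orthonormalPoly (laguerreMeasure β) y t)) t := by
    intro t
    by_cases ht : t ∈ Set.Iio r <;> simp [ht]
  simp only [h1]
  rw [setIntegral_indicator measurableSet_Iio, Set.Ioi_inter_Iio, ← integral_const_mul,
    ← integral_const_mul]
  refine integral_congr_ae (ae_of_all _ fun t => ?_)
  simp only [orthonormalPoly_laguerre hβ]
  have hs : ∀ n : ℕ, Real.sqrt ((ascPochhammer ℝ n).eval β / (Real.Gamma β * (n.factorial : ℝ))) =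
      Real.sqrt ((ascPochhammer ℝ n).eval β / (n.factorial : ℝ)) / Real.sqrt (Real.Gamma β) := by
    intro n
    rw [← Real.sqrt_div' _ hG.le, div_div, mul_comm (Real.Gamma β)]
  rw [hs, hs, Real.sqrt_mul (by positivity)]
  have e1 : (-1 : ℝ) ^ (x + y) * ((-1) ^ x * (-1) ^ y) = 1 := by
    rw [← pow_add, ← mul_pow]
    simp
  have e2 : (Real.sqrt (Real.Gamma β))⁻¹ * (Real.sqrt (Real.Gamma β))⁻¹ = (Real.Gamma β)⁻¹ := by
    rw [← mul_inv, Real.mul_self_sqrt hG.le]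
  set X := Real.sqrt ((ascPochhammer ℝ x).eval β / (x.factorial : ℝ))
  set Y := Real.sqrt ((ascPochhammer ℝ y).eval β / (y.factorial : ℝ))
  set LX := (laguerrePoly β x).eval t
  set LY := (laguerrePoly β y).eval t
  rw [← e2]
  linear_combination (t ^ (β - 1) * Real.exp (-t) * X * Y * LX * LY *
    (Real.sqrt (Real.Gamma β))⁻¹ * (Real.sqrt (Real.Gamma β))⁻¹) * e1

theorem tendsto_sum_meixner {β r : ℝ} (hβ : 0 < β) {ξ : ℕ → ℝ}
    (hξ0 : ∀ᶠ N in atTop, 0 < ξ N ∧ ξ N < 1) (hξ : Tendsto ξ atTop (𝓝 1))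
    (hr : 0 < r) (hlim : Tendsto (fun N : ℕ => (1 - ξ N) * (N : ℝ)) atTop (𝓝 r)) (x y : ℕ) :
    Tendsto (fun N => ∑ n ∈ Finset.range N, (1 - ξ N) ^ β * meixnerWeight β (ξ N) n *
        ((meixnerPoly β (ξ N) x).eval (n : ℝ) * (meixnerPoly β (ξ N) y).eval (n : ℝ))) atTop
      (𝓝 (∫ t in Set.Ioo 0 r, (Real.Gamma β)⁻¹ * t ^ (β - 1) * Real.exp (-t) *
        ((laguerrePoly β x).eval t * (laguerrePoly β y).eval t))) := by
  -- The endpoint `N * (1 - ξ N)` moves with `N`, so all integrals are placed on the fixed interval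
  -- `(0, R)`, with the cut-off carried by an indicator.
  set R := r + 1 with hRdef
  set a : ℕ → ℕ → ℝ := fun N n => (1 - ξ N) ^ (β - 1) * meixnerWeight β (ξ N) n *
    ((meixnerPoly β (ξ N) x).eval (n : ℝ) * (meixnerPoly β (ξ N) y).eval (n : ℝ)) with ha
  set F : ℕ → ℝ → ℝ := fun N => (Set.Iio ((N : ℝ) * (1 - ξ N))).indicator
    (fun t => a N ⌊t / (1 - ξ N)⌋₊) with hF
  set f : ℝ → ℝ := (Set.Iio r).indicator (fun t => (Real.Gamma β)⁻¹ * t ^ (β - 1) * Real.exp (-t) *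
        ((laguerrePoly β x).eval t * (laguerrePoly β y).eval t)) with hf
  have hδ0 : ∀ᶠ N in atTop, 0 < 1 - ξ N := hξ0.mono fun N hN => by linarith [hN.2]
  have hδ : Tendsto (fun N => 1 - ξ N) atTop (𝓝 0) := by simpa using hξ.const_sub 1
  have hNR : ∀ᶠ N : ℕ in atTop, (N : ℝ) * (1 - ξ N) < R := by
    filter_upwards [hlim.eventually (gt_mem_nhds (by linarith : r < R))] with N hN
    linarith
  have hhalf : ∀ᶠ N in atTop, 1 / 2 ≤ ξ N :=
    (hξ.eventually (lt_mem_nhds (by norm_num : (1 / 2 : ℝ) < 1))).mono fun N hN => hN.le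
  obtain ⟨C, hC0, hC⟩ := exists_ascPochhammer_div_factorial_le hβ
  set B : ℕ → ℝ := fun x => ∑ k ∈ Finset.range (x + 1),
      (x.choose k : ℝ) / (ascPochhammer ℝ k).eval β * (2 * R) ^ k with hB
  have hR0 : 0 < R := by linarith
  have hfR : ∫ t in Set.Ioo 0 R, f t = ∫ t in Set.Ioo 0 r, (Real.Gamma β)⁻¹ * t ^ (β - 1) *
      Real.exp (-t) * ((laguerrePoly β x).eval t * (laguerrePoly β y).eval t) := by
    rw [hf, setIntegral_indicator measurableSet_Iio, Set.Ioo_inter_Iio, min_eq_right (by linarith)]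
  rw [← hfR]
  have hFR : ∀ᶠ N in atTop, ∫ t in Set.Ioo 0 R, F N t =
      ∑ n ∈ Finset.range N, (1 - ξ N) ^ β * meixnerWeight β (ξ N) n *
        ((meixnerPoly β (ξ N) x).eval (n : ℝ) * (meixnerPoly β (ξ N) y).eval (n : ℝ)) := by
    filter_upwards [hδ0, hNR] with N h0 hR
    rw [hF, setIntegral_indicator measurableSet_Iio, Set.Ioo_inter_Iio, min_eq_right hR.le,
      ← sum_mul_eq_setIntegral h0]
    refine Finset.sum_congr rfl fun n _ => ?_
    have : (1 - ξ N) ^ β = (1 - ξ N) * (1 - ξ N) ^ (β - 1) := by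
      rw [← Real.rpow_one_add' h0.le (by simpa using hβ.ne')]
      congr 1
      ring
    rw [ha, this]
    ring
  refine Tendsto.congr' hFR ?_
  refine tendsto_integral_filter_of_dominated_convergence
    (fun t => C * (t ^ (β - 1) + R ^ (β - 1)) * (B x * B y)) ?_ ?_ ?_ ?_
  · refine Eventually.of_forall fun N => Measurable.aestronglyMeasurable ?_
    refine Measurable.indicator ?_ measurableSet_Iio
    exact (measurable_from_nat (f := a N)).comp
      (Nat.measurable_floor.comp (measurable_id.div_const _))
  · filter_upwards [hδ0, hNR, hhalf, hξ0] with N h0 hR hh hN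
    refine (ae_restrict_mem measurableSet_Ioo).mono fun t ht => ?_
    have hBx : ∀ z, 0 ≤ B z := fun z => Finset.sum_nonneg fun k _ => by
      have := ascPochhammer_pos k β hβ
      positivity
    have htp : 0 ≤ t ^ (β - 1) := Real.rpow_nonneg ht.1.le _
    have hRp : 0 ≤ R ^ (β - 1) := Real.rpow_nonneg hR0.le _
    by_cases htN : t ∈ Set.Iio ((N : ℝ) * (1 - ξ N))
    · rw [hF]
      simp only [Set.indicator_of_mem htN]
      set n := ⌊t / (1 - ξ N)⌋₊ with hn
      have hnN : n + 1 ≤ N := by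
        rw [Nat.succ_le_iff, hn, Nat.floor_lt (by have := ht.1; positivity), div_lt_iff₀ h0]
        exact htN
      have hnN' : (n : ℝ) + 1 ≤ N := by exact_mod_cast hnN
      have hlow : t ≤ (1 - ξ N) * ((n : ℝ) + 1) := by
        have := (Nat.lt_floor_add_one (t / (1 - ξ N))).le
        rw [div_le_iff₀ h0] at this
        linarith
      have hup : (1 - ξ N) * ((n : ℝ) + 1) ≤ R := by nlinarith
      have hupn : (1 - ξ N) * (n : ℝ) ≤ R := by nlinarith
      -- The base lies between `t` and `R`. The power is bounded by its value at `R` if `β ≥ 1` and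
      -- at `t` if `β ≤ 1`; the sum covers both cases and is integrable at `0` since `β > 0`.
      have hrp : ((1 - ξ N) * ((n : ℝ) + 1)) ^ (β - 1) ≤ t ^ (β - 1) + R ^ (β - 1) := by
        rcases le_total 0 (β - 1) with h | h
        · have := Real.rpow_le_rpow (by positivity) hup h
          linarith
        · have := Real.rpow_le_rpow_of_nonpos ht.1 hlow h
          linarith
      have hapos := ascPochhammer_pos n β hβ
      rw [ha, Real.norm_eq_abs, abs_mul, abs_mul (Polynomial.eval _ _), rpow_mul_meixnerWeight hβ hN.2]
      have hξn : ξ N ^ n ≤ 1 := pow_le_one₀ hN.1.le hN.2.le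
      have hξn0 : 0 ≤ ξ N ^ n := pow_nonneg hN.1.le _
      have hc0 : 0 ≤ (ascPochhammer ℝ n).eval β / (n.factorial : ℝ) * ((n : ℝ) + 1) ^ (1 - β) := by
        positivity
      have hs0 : 0 ≤ ((1 - ξ N) * ((n : ℝ) + 1)) ^ (β - 1) := by positivity
      rw [abs_of_nonneg (by positivity)]
      refine mul_le_mul ?_ (mul_le_mul (abs_meixnerPoly_eval_le hβ hh hN.2 hupn x)
        (abs_meixnerPoly_eval_le hβ hh hN.2 hupn y) (abs_nonneg _) (hBx x)) (by positivity)
        (by positivity)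
      calc _ ≤ C * (t ^ (β - 1) + R ^ (β - 1)) * 1 := by
            gcongr
            exact hC n
        _ = _ := mul_one _
    · rw [hF]
      simp only [Set.indicator_of_notMem htN, norm_zero]
      have := hBx x
      have := hBx y
      positivity
  · refine Integrable.mul_const (Integrable.const_mul (Integrable.add ?_ ?_) _) _
    · have := (intervalIntegral.intervalIntegrable_rpow' (a := 0) (b := R) (r := β - 1)
        (by linarith))
      rwa [intervalIntegrable_iff_integrableOn_Ioo_of_le hR0.le] at this
    · exact integrableOn_const (by simp)
  -- At `t = r` the moving indicators need not converge, so this null set is discarded.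
  · have hne : ∀ᵐ t ∂(volume.restrict (Set.Ioo 0 R)), t ≠ r :=
      ae_restrict_of_ae (by simp [ae_iff])
    filter_upwards [ae_restrict_mem measurableSet_Ioo, hne] with t ht htr
    have hfloor := tendsto_mul_floor_div hδ0 hδ ht.1
    have hlim' : Tendsto (fun N : ℕ => (N : ℝ) * (1 - ξ N)) atTop (𝓝 r) :=
      hlim.congr fun N => mul_comm _ _
    rcases lt_or_gt_of_ne htr with h | h
    · have hmem : t ∈ Set.Iio r := h
      rw [hf, Set.indicator_of_mem hmem]
      have hev : ∀ᶠ N : ℕ in atTop, F N t = a N ⌊t / (1 - ξ N)⌋₊ :=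
        (hlim'.eventually (lt_mem_nhds h)).mono fun N hN =>
          Set.indicator_of_mem (show t ∈ Set.Iio ((N : ℝ) * (1 - ξ N)) from hN) _
      refine Tendsto.congr' (hev.mono fun N hN => hN.symm) ?_
      have hn_top : Tendsto (fun N => ⌊t / (1 - ξ N)⌋₊) atTop atTop := by
        refine tendsto_nat_floor_atTop.comp ?_
        have : Tendsto (fun N => (1 - ξ N)⁻¹) atTop atTop :=
          tendsto_inv_nhdsGT_zero.comp (tendsto_nhdsWithin_iff.mpr ⟨hδ, hδ0⟩)
        exact this.const_mul_atTop ht.1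
      have h1 := (tendsto_ascPochhammer_div_factorial hβ).comp hn_top
      have h2 : Tendsto (fun N => ((1 - ξ N) * ((⌊t / (1 - ξ N)⌋₊ : ℝ) + 1)) ^ (β - 1)) atTop
          (𝓝 (t ^ (β - 1))) := by
        refine Tendsto.rpow_const ?_ (Or.inl ht.1.ne')
        have := hfloor.add hδ
        rw [add_zero] at this
        refine this.congr fun N => ?_
        ring
      have h3 := tendsto_pow_exp_neg hξ0 hξ hfloor
      have hξ0' := hξ0.mono fun N hN => hN.1
      have h4 := (tendsto_meixnerPoly_eval β hξ0' hξ hfloor x).mul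
        (tendsto_meixnerPoly_eval β hξ0' hξ hfloor y)
      refine (((h1.mul h2).mul h3).mul h4).congr' ?_
      filter_upwards [hξ0] with N hN
      simp only [ha, rpow_mul_meixnerWeight hβ hN.2, Function.comp_apply]
    · have hnot : t ∉ Set.Iio r := not_lt.mpr h.le
      rw [hf, Set.indicator_of_notMem hnot]
      refine tendsto_const_nhds.congr' ?_
      filter_upwards [hlim'.eventually (gt_mem_nhds h)] with N hN
      have hN' : t ∉ Set.Iio ((N : ℝ) * (1 - ξ N)) := not_lt.mpr hN.le
      exact (Set.indicator_of_notMem hN' _).symm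

theorem tendsto_meixnerKernel {β r : ℝ} (hβ : 0 < β) (hr : 0 < r) {ξ : ℕ → ℝ}
    (hξ : ∀ N : ℕ, 1 ≤ N → ξ N ∈ Set.Ioo (0 : ℝ) 1)
    (hlim : Tendsto (fun N : ℕ => (1 - ξ N) * (N : ℝ)) atTop (𝓝 r)) (x y : ℕ) :
    Tendsto (fun N => meixnerKernel N β (ξ N) x y) atTop
      (𝓝 ((-1 : ℝ) ^ (x + y) * discreteLaguerreKernelMinus r β x y)) := by
  have hξ0 : ∀ᶠ N in atTop, 0 < ξ N ∧ ξ N < 1 :=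
    (eventually_ge_atTop 1).mono fun N hN => hξ N hN
  -- Dividing `(1 - ξ N) * N → r` by `N` forces `1 - ξ N → 0`.
  have hξ1 : Tendsto ξ atTop (𝓝 1) := by
    have h := (hlim.mul (tendsto_inv_atTop_nhds_zero_nat (𝕜 := ℝ))).const_sub 1
    rw [mul_zero, sub_zero] at h
    refine h.congr' ?_
    filter_upwards [eventually_ge_atTop 1] with N hN
    have : (N : ℝ) ≠ 0 := by positivity
    field_simp
    ring
  have hW : ∀ x, Tendsto (fun N => meixnerWeight β (ξ N) x) atTop
      (𝓝 ((ascPochhammer ℝ x).eval β / (x.factorial : ℝ))) := by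
    intro x
    simp only [meixnerWeight_eq hβ]
    simpa using (hξ1.pow x).const_mul ((ascPochhammer ℝ x).eval β / (x.factorial : ℝ))
  rw [discreteLaguerreKernelMinus_eq hβ]
  refine (((hW x).mul (hW y)).sqrt.mul (tendsto_sum_meixner hβ hξ0 hξ1 hr hlim x y)).congr' ?_
  filter_upwards [hξ0] with N hN
  rw [meixnerKernel_eq hβ hN.1 hN.2]

end

/-! ### The limit theorem. -/

theorem mainTheorem2 (β r : ℝ) (hβ : 0 < β) (hr : 0 < r) (ξ : ℕ → ℝ)
    (hξ : ∀ N : ℕ, 1 ≤ N → ξ N ∈ Set.Ioo (0 : ℝ) 1)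
    (hlim : Tendsto (fun N : ℕ => (1 - ξ N) * (N : ℝ)) atTop (𝓝 r)) :
    (∀ N : ℕ, 1 ≤ N →
      ∃! P : ProbabilityMeasure Conf, IsDeterminantal P (meixnerKernel N β (ξ N))) ∧
    (∃! P : ProbabilityMeasure Conf, IsDeterminantal P (discreteLaguerreKernelMinus r β)) ∧
    (∀ (M : ℕ → ProbabilityMeasure Conf) (D : ProbabilityMeasure Conf),
      (∀ N : ℕ, 1 ≤ N → IsDeterminantal (M N) (meixnerKernel N β (ξ N))) →
      IsDeterminantal D (discreteLaguerreKernelMinus r β) →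
      Tendsto M atTop (𝓝 D)) ∧
    (∃ (T : ℕ → EllTwo →L[ℝ] EllTwo) (S : EllTwo →L[ℝ] EllTwo),
      (∀ N : ℕ, 1 ≤ N → IsProjectionWithKernel (T N) (meixnerKernel N β (ξ N))) ∧
      IsProjectionWithKernel S
        (fun x y => (-1 : ℝ) ^ (x + y) * discreteLaguerreKernelMinus r β x y) ∧
      ∀ v : EllTwo, Tendsto (fun N => T N v) atTop (𝓝 (S v))) := by
  have hproj : ∀ N : ℕ, ∃ T : EllTwo →L[ℝ] EllTwo,
      IsProjectionWithKernel T (meixnerKernel N β (ξ N)) := by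
    intro N
    -- At `N = 0` nothing is known about `ξ 0`, but the kernel is an empty sum and the zero operator
    -- serves.
    rcases Nat.eq_zero_or_pos N with rfl | hN
    · exact ⟨0, IsStarProjection.zero _, fun x y => by simp [meixnerKernel]⟩
    · exact exists_isProjectionWithKernel_meixner hβ (hξ N hN).1 (hξ N hN).2 N
  choose T hT using hproj
  obtain ⟨S, hS⟩ := exists_isProjectionWithKernel_discreteLaguerre hβ r
  have hK := tendsto_meixnerKernel hβ hr hξ hlim
  refine ⟨fun N _ => (hT N).existsUnique_isDeterminantal, ?_, fun M D hM hD => ?_,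
    T, S, fun N _ => hT N, hS, IsProjectionWithKernel.tendsto hT hS hK⟩
  · simpa only [isDeterminantal_conj_sign] using hS.existsUnique_isDeterminantal
  · exact IsDeterminantal.tendsto hM ((isDeterminantal_conj_sign D _).mpr hD) hK
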